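/- For a partition $P$ of the set $\{1,2,3\}$, let $SG^{P}\subset SO(3)$ be the group of diagonal matrices with entries $\pm1$ such that, for every part $S$ of $P$, the product of the diagonal entries with index in $S$ is $1$. (For example, if $P=\{\{1\},\{2,3\}\}$, then $SG^{P}=\{\operatorname{diag}(1,1,1),\operatorname{diag}(1,-1,-1)\}$.) Put $F\ell((1,1,1);P)=SO(3)/SG^{P}$, the space of left cosets. Endow $SO(3)$ with the bi-invariant Riemannian metric $\langle X,Y\rangle=\tfrac12\operatorname{tr}(X^{T}Y)$ (so that the distance from the identity to a rotation by the angle $\theta\in[0,\pi]$ is $\theta$), and $F\ell((1,1,1);P)$ with the quotient Riemannian metric, for which $SO(3)\to F\ell((1,1,1);P)$ is a Riemannian submersion. Let $d$ be the resulting geodesic distance, and call the push-forward of the Haar probability measure of $SO(3)$ the uniform distribution on $F\ell((1,1,1);P)$. **Theorem.** Let $P$ be a proper partition of $\{1,2,3\}$, that is, one of $$P_1=\{\{1\},\{2,3\}\},\qquad P_2=\{\{2\},\{1,3\}\},\qquad P_3=\{\{3\},\{1,2\}\},$$ so that $F\ell((1,1,1);P)$ is the manifold of partially oriented $(1,2,3)$-flags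 of type $P$ in $\mathbb R^3$. If $x$ and $y$ are independent uniformly distributed random points of $F\ell((1,1,1);P)$, then $d$ is finite, $d(x,y)$ is integrable, and $$\mathbb E[d(x,y)]=1+\frac{\pi}{4}.$$ -/

import Mathlib

open MeasureTheory ProbabilityTheory
open scoped ENNReal Topology Matrix

noncomputable section

namespace OrientedFlag

/-- The group `SO(n)` of real orthogonal `n × n` matrices of determinant one
(with the topology induced by the entries). -/
abbrev SO (n : ℕ) : Type := ↥(Matrix.specialOrthogonalGroup (Fin n) ℝ)

theorem continuous_coe (n : ℕ) : Continuous fun A : SO n => (A : Matrix (Fin n) (Fin n) ℝ) :=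
  continuous_subtype_val

theorem coe_inv {n : ℕ} (A : SO n) :
    ((A⁻¹ : SO n) : Matrix (Fin n) (Fin n) ℝ) = (A : Matrix (Fin n) (Fin n) ℝ)ᵀ := rfl

instance instIsTopologicalGroupSO (n : ℕ) : IsTopologicalGroup (SO n) where
  continuous_inv := by
    refine Continuous.subtype_mk (f := fun A : SO n => (A : Matrix (Fin n) (Fin n) ℝ)ᵀ) ?_ _
    exact (continuous_coe n).matrix_transpose

theorem abs_entry_le_one {n : ℕ} (A : SO n) (i j : Fin n) :
    |(A : Matrix (Fin n) (Fin n) ℝ) i j| ≤ 1 := by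
  have h : (A : Matrix (Fin n) (Fin n) ℝ) * (A : Matrix (Fin n) (Fin n) ℝ)ᵀ = 1 :=
    (Matrix.mem_orthogonalGroup_iff (Fin n) ℝ).1 (Matrix.mem_specialOrthogonalGroup_iff.1 A.2).1
  have h2 := congrFun (congrFun h i) i
  rw [Matrix.mul_apply, Matrix.one_apply_eq] at h2
  have h3 := Finset.single_le_sum
    (f := fun k => (A : Matrix (Fin n) (Fin n) ℝ) i k * (A : Matrix (Fin n) (Fin n) ℝ)ᵀ k i)
    (fun k _ => mul_self_nonneg _) (Finset.mem_univ j)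
  rw [h2] at h3
  have h4 : (A : Matrix (Fin n) (Fin n) ℝ) i j * (A : Matrix (Fin n) (Fin n) ℝ) i j ≤ 1 := h3
  exact abs_le_one_iff_mul_self_le_one.2 h4

instance instCompactSpaceSO (n : ℕ) : CompactSpace (SO n) := by
  refine isCompact_iff_compactSpace.1 ?_
  have hK : IsCompact (Set.univ.pi fun _ : Fin n => Set.univ.pi fun _ : Fin n =>
      Set.Icc (-1 : ℝ) 1) :=
    isCompact_univ_pi fun _ => isCompact_univ_pi fun _ => isCompact_Icc
  have hc : IsClosed ({A | A * Aᵀ = 1 ∧ A.det = 1} : Set (Matrix (Fin n) (Fin n) ℝ)) := by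
    refine IsClosed.inter ?_ ?_
    · exact isClosed_eq (continuous_id.mul continuous_id.matrix_transpose) continuous_const
    · exact isClosed_eq continuous_id.matrix_det continuous_const
  have he : ((Matrix.specialOrthogonalGroup (Fin n) ℝ : Set (Matrix (Fin n) (Fin n) ℝ))) =
      {A | A * Aᵀ = 1 ∧ A.det = 1} := by
    ext A
    rw [SetLike.mem_coe, Matrix.mem_specialOrthogonalGroup_iff, Matrix.mem_orthogonalGroup_iff]
    rfl
  have hs : ((Matrix.specialOrthogonalGroup (Fin n) ℝ : Set (Matrix (Fin n) (Fin n) ℝ))) ⊆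
      (Set.univ.pi fun _ : Fin n => Set.univ.pi fun _ : Fin n => Set.Icc (-1 : ℝ) 1) :=
    fun A hA i _ j _ => abs_le.1 (abs_entry_le_one ⟨A, hA⟩ i j)
  exact IsCompact.of_isClosed_subset hK (he ▸ hc) hs

instance instMeasurableSpaceSO (n : ℕ) : MeasurableSpace (SO n) := borel (SO n)

instance instBorelSpaceSO (n : ℕ) : BorelSpace (SO n) := ⟨rfl⟩

/-- The Haar probability measure on `SO(n)`. -/
def haarSO (n : ℕ) : Measure (SO n) := Measure.haarMeasure ⊤

section Blocks

variable {n : ℕ}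

/-- `λ` is an ordered partition of the integer `n` (a `Composition`), and `c.index i` is the
number of the block that contains the coordinate `i`. The matrix `A` is block diagonal when
its entries between different blocks vanish. -/
def IsBlockDiagonal (c : Composition n) (A : Matrix (Fin n) (Fin n) ℝ) : Prop :=
  ∀ i j, c.index i ≠ c.index j → A i j = 0

/-- The square submatrix of `A` on the coordinates in those blocks whose number lies in `S`. -/
def subBlock (c : Composition n) (S : Finset (Fin c.length)) (A : Matrix (Fin n) (Fin n) ℝ) :
    Matrix {i : Fin n // c.index i ∈ S} {i : Fin n // c.index i ∈ S} ℝ :=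
  A.submatrix Subtype.val Subtype.val

theorem IsBlockDiagonal.mul {c : Composition n} {A B : Matrix (Fin n) (Fin n) ℝ}
    (hA : IsBlockDiagonal c A) (hB : IsBlockDiagonal c B) : IsBlockDiagonal c (A * B) := by
  intro i j hij
  rw [Matrix.mul_apply]
  refine Finset.sum_eq_zero fun k _ => ?_
  by_cases hk : c.index i = c.index k
  · rw [hB k j (hk ▸ hij), mul_zero]
  · rw [hA i k hk, zero_mul]

theorem subBlock_mul {c : Composition n} (S : Finset (Fin c.length))
    {A : Matrix (Fin n) (Fin n) ℝ} (B : Matrix (Fin n) (Fin n) ℝ) (hA : IsBlockDiagonal c A) :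
    subBlock c S (A * B) = subBlock c S A * subBlock c S B := by
  ext i j
  simp only [subBlock, Matrix.submatrix_apply, Matrix.mul_apply]
  rw [← Fintype.sum_subtype_add_sum_subtype (fun k => c.index k ∈ S)
    (fun k => A i.1 k * B k j.1)]
  refine add_eq_left.2 (Finset.sum_eq_zero fun k _ => ?_)
  rw [hA i.1 k.1 (fun h => k.2 (h ▸ i.2)), zero_mul]

/-- The special orthogonal partition `SG_λ^P`: the block diagonal matrices in `SO(n)` whose
diagonal block over each part of `P` (the direct sum of the blocks with number in that part)
has determinant one. Since a block diagonal matrix is orthogonal exactly when its diagonal blocks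
are, this is the product over the parts `{i₁, …, iₘ}` of `P` of the groups
`S(O(λ_{i₁}) × ⋯ × O(λ_{iₘ}))`. -/
def SG (c : Composition n) (P : Finpartition (Finset.univ : Finset (Fin c.length))) :
    Subgroup (SO n) where
  carrier := {A | IsBlockDiagonal c (A : Matrix (Fin n) (Fin n) ℝ) ∧
    ∀ S ∈ P.parts, (subBlock c S (A : Matrix (Fin n) (Fin n) ℝ)).det = 1}
  mul_mem' := by
    rintro A B ⟨hA, hA'⟩ ⟨hB, hB'⟩
    refine ⟨hA.mul hB, fun S hS => ?_⟩
    have h := subBlock_mul S (B : Matrix (Fin n) (Fin n) ℝ) hA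
    change (subBlock c S ((A : Matrix (Fin n) (Fin n) ℝ) * (B : Matrix (Fin n) (Fin n) ℝ))).det = 1
    rw [h, Matrix.det_mul, hA' S hS, hB' S hS, mul_one]
  one_mem' := by
    refine ⟨fun i j hij => Matrix.one_apply_ne fun h => hij (h ▸ rfl), fun S _ => ?_⟩
    have h : subBlock c S (1 : Matrix (Fin n) (Fin n) ℝ) = 1 :=
      Matrix.submatrix_one _ Subtype.val_injective
    change (subBlock c S (1 : Matrix (Fin n) (Fin n) ℝ)).det = 1
    rw [h, Matrix.det_one]
  inv_mem' := by
    rintro A ⟨hA, hA'⟩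
    refine ⟨fun i j hij => ?_, fun S hS => ?_⟩
    · rw [coe_inv, Matrix.transpose_apply]
      exact hA j i hij.symm
    · rw [coe_inv]
      change (subBlock c S (A : Matrix (Fin n) (Fin n) ℝ))ᵀ.det = 1
      rw [Matrix.det_transpose, hA' S hS]

/-- A partition of the index set is proper if it is neither the trivial partition (with the whole
index set as its only part) nor the complete partition `⊥` (all of whose parts are singletons). -/
def IsProperPartition {c : Composition n}
    (P : Finpartition (Finset.univ : Finset (Fin c.length))) : Prop :=
  P.parts ≠ {Finset.univ} ∧ P ≠ ⊥

/-- The orbit space `Fℓ(λ; P) = SO(n) / SG_λ^P` of left cosets. -/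
def Fl (c : Composition n) (P : Finpartition (Finset.univ : Finset (Fin c.length))) : Type :=
  SO n ⧸ SG c P

end Blocks

namespace Fl

variable {n : ℕ} {c : Composition n} {P : Finpartition (Finset.univ : Finset (Fin c.length))}

/-- The projection `SO(n) → SO(n) / SG_λ^P`. -/
def proj (c : Composition n) (P : Finpartition (Finset.univ : Finset (Fin c.length))) (A : SO n) :
    Fl c P :=
  (QuotientGroup.mk A : SO n ⧸ SG c P)

/-- The quotient topology. -/
instance instTopologicalSpaceFl : TopologicalSpace (Fl c P) :=
  inferInstanceAs (TopologicalSpace (SO n ⧸ SG c P))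

instance instMeasurableSpaceFl : MeasurableSpace (Fl c P) := borel (Fl c P)

instance instBorelSpaceFl : BorelSpace (Fl c P) := ⟨rfl⟩

/-- The uniform probability measure on `Fℓ(λ; P)`: the push-forward of the Haar probability
measure of `SO(n)`. -/
def uniform (c : Composition n) (P : Finpartition (Finset.univ : Finset (Fin c.length))) :
    Measure (Fl c P) :=
  (haarSO n).map (proj c P)

/-- Near the time `t`, the curve `g` in `SO(n)` is a continuously differentiable lift of the
curve `γ` in `Fℓ(λ; P)`. -/
def IsLocalLift (γ : ℝ → Fl c P) (t : ℝ) (g : ℝ → SO n) : Prop :=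
  (∀ i j, ContDiffAt ℝ 1 (fun s => (g s : Matrix (Fin n) (Fin n) ℝ) i j) t) ∧
    ∀ᶠ s in 𝓝 t, proj c P (g s) = γ s

/-- A `C¹` curve in `Fℓ(λ; P)`. Since `SO(n) → Fℓ(λ; P)` is a surjective submersion (with local
sections), a curve is `C¹` exactly when it has `C¹` lifts near every time. -/
def IsC1Curve (γ : ℝ → Fl c P) : Prop :=
  ∀ t, ∃ g, IsLocalLift γ t g

/-- The norm of a tangent vector `X` (a matrix) to `SO(n)` in the bi-invariant Riemannian metric
`⟨X, Y⟩ = ½ tr(Xᵀ Y)`, for which a rotation of `ℝ³` by the angle `θ ∈ [0, π]` has distance `θ`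
from the identity. -/
def tangentNorm (X : Matrix (Fin n) (Fin n) ℝ) : ℝ :=
  Real.sqrt ((Xᵀ * X).trace / 2)

/-- The velocity at time `t` of a curve in `SO(n)`, as a matrix. -/
def velocity (g : ℝ → SO n) (t : ℝ) : Matrix (Fin n) (Fin n) ℝ :=
  Matrix.of fun i j => deriv (fun s => (g s : Matrix (Fin n) (Fin n) ℝ) i j) t

/-- The norm of the velocity of `γ` at time `t` in the quotient Riemannian metric, that is, the
metric for which `SO(n) → Fℓ(λ; P)` is a Riemannian submersion: the norm of a tangent vector `v` of
the quotient is the norm of its horizontal lift, which is the least norm of a tangent vector to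
`SO(n)` mapped to `v`. The tangent vectors over `γ'(t)` are the velocities at `t` of the `C¹`
local lifts of `γ`. -/
def speed (γ : ℝ → Fl c P) (t : ℝ) : ℝ≥0∞ :=
  ⨅ (g : ℝ → SO n) (_ : IsLocalLift γ t g), ENNReal.ofReal (tangentNorm (velocity g t))

/-- The length of a curve over the time interval `[0, 1]`. -/
def length (γ : ℝ → Fl c P) : ℝ≥0∞ :=
  ∫⁻ t in Set.Icc (0 : ℝ) 1, speed γ t

/-- The geodesic (Riemannian) distance: the infimum of the lengths of the `C¹` curves from
`x` to `y`; it is infinite if there is no such curve. -/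
def geodesicEDist (x y : Fl c P) : ℝ≥0∞ :=
  ⨅ (γ : ℝ → Fl c P) (_ : IsC1Curve γ ∧ γ 0 = x ∧ γ 1 = y), length γ

/-- The geodesic distance as a real number. -/
def geodesicDist (x y : Fl c P) : ℝ :=
  (geodesicEDist x y).toReal

end Fl

end OrientedFlag

end

/-! The isotropy group of a proper partition is `{1, halfTurn a}` for one coordinate axis `a`
(`exists_mem_SG_iff`), so the flag manifold is a quotient of `SO 3` by a group of order two. There
are two halves: identify the geodesic distance, then average it.

Distance. It is the least angle of the two rotations in the coset, `cosetAngle (halfTurn a) (A⁻¹ *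
B)` (`geodesicEDist_proj`). The upper bound comes from one-parameter subgroups, which have constant
speed. For the lower bound, all `C¹` lifts at a given time have the same speed because the isotropy
group is finite. Along a curve the coset angle from the start grows no faster than the length, by
the triangle inequality for angles and the fact that angle and chord agree to first order.

Average. By left invariance of Haar measure, the expectation is the mean of `cosetAngle` over `SO 3`
(`integral_geodesicDist`). A unit quaternion `q` represents a rotation of angle `2 arccos |re q|`,
and Haar measure is the image of Lebesgue measure on the unit ball of the quaternions
(`lintegral_haarSO`). Passing to the other element of the coset replaces `q` by `q i_a`, whose real
part is minus the `i_a`-coordinate of `q`. Hence the distance is `2 arccos (max |q_0| |q_a|)`, where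
`q_0 = re q`. Polar coordinates in the planes `(1, i_a)` and its complement give `q_0 = cos χ cos φ`
and `q_a = cos χ sin φ`, with `φ` uniform and `χ` of density `2 cos χ sin χ` on `(0, π/2)`. What
remains are two elementary integrals, over `χ` (`meanAngle_eq`) and over `φ` (`integral_meanAngle`).
-/

noncomputable section

namespace OrientedFlag

/-! ### Quaternions and the double cover of the rotation group -/

section Rotations

open Quaternion

/-- The matrix of `v ↦ q v q̄` on the imaginary quaternions: `normSq q` times a rotation. -/
def rotMat (q : ℍ[ℝ]) : Matrix (Fin 3) (Fin 3) ℝ :=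
  !![q.re ^ 2 + q.imI ^ 2 - q.imJ ^ 2 - q.imK ^ 2, 2 * (q.imI * q.imJ - q.re * q.imK),
      2 * (q.imI * q.imK + q.re * q.imJ);
    2 * (q.imI * q.imJ + q.re * q.imK), q.re ^ 2 - q.imI ^ 2 + q.imJ ^ 2 - q.imK ^ 2,
      2 * (q.imJ * q.imK - q.re * q.imI);
    2 * (q.imI * q.imK - q.re * q.imJ), 2 * (q.imJ * q.imK + q.re * q.imI),
      q.re ^ 2 - q.imI ^ 2 - q.imJ ^ 2 + q.imK ^ 2]

theorem rotMat_mul (p q : ℍ[ℝ]) : rotMat (p * q) = rotMat p * rotMat q := by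
  ext i j
  fin_cases i <;> fin_cases j <;>
    simp [rotMat, Matrix.mul_apply, Fin.sum_univ_succ] <;> ring

theorem rotMat_mul_transpose (q : ℍ[ℝ]) :
    rotMat q * (rotMat q)ᵀ = (normSq q ^ 2) • (1 : Matrix (Fin 3) (Fin 3) ℝ) := by
  ext i j
  fin_cases i <;> fin_cases j <;>
    simp [rotMat, Matrix.mul_apply, Fin.sum_univ_succ, normSq_def'] <;> ring

theorem det_rotMat (q : ℍ[ℝ]) : (rotMat q).det = normSq q ^ 3 := by
  simp only [Matrix.det_fin_three, rotMat, normSq_def']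
  simp
  ring

theorem trace_rotMat (q : ℍ[ℝ]) : (rotMat q).trace = 4 * q.re ^ 2 - normSq q := by
  simp only [Matrix.trace_fin_three, rotMat, normSq_def']
  simp
  ring

theorem rotMat_smul (c : ℝ) (q : ℍ[ℝ]) : rotMat (c • q) = c ^ 2 • rotMat q := by
  ext i j
  fin_cases i <;> fin_cases j <;> simp [rotMat] <;> ring

theorem mem_SO {n : ℕ} {A : Matrix (Fin n) (Fin n) ℝ} :
    A ∈ Matrix.specialOrthogonalGroup (Fin n) ℝ ↔ A * Aᵀ = 1 ∧ A.det = 1 := by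
  rw [Matrix.mem_specialOrthogonalGroup_iff, Matrix.mem_orthogonalGroup_iff]

theorem normalized_rotMat_mem {q : ℍ[ℝ]} (hq : q ≠ 0) :
    (normSq q)⁻¹ • rotMat q ∈ Matrix.specialOrthogonalGroup (Fin 3) ℝ := by
  have h : normSq q ≠ 0 := normSq_ne_zero.2 hq
  refine mem_SO.2 ⟨?_, ?_⟩
  · rw [Matrix.transpose_smul, Matrix.smul_mul, Matrix.mul_smul, rotMat_mul_transpose, smul_smul,
      smul_smul]
    rw [show (normSq q)⁻¹ * (normSq q)⁻¹ * normSq q ^ 2 = 1 by field_simp, one_smul]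
  · rw [Matrix.det_smul, det_rotMat, Fintype.card_fin, inv_pow, inv_mul_cancel₀ (pow_ne_zero 3 h)]

open Classical in
/-- The rotation of `ℝ³` defined by a nonzero quaternion. -/
def toSO (q : ℍ[ℝ]) : SO 3 :=
  if h : q ≠ 0 then ⟨(normSq q)⁻¹ • rotMat q, normalized_rotMat_mem h⟩ else 1

theorem coe_toSO {q : ℍ[ℝ]} (hq : q ≠ 0) :
    (toSO q : Matrix (Fin 3) (Fin 3) ℝ) = (normSq q)⁻¹ • rotMat q := by
  rw [toSO, dif_pos hq]

theorem coe_toSO_of_normSq {q : ℍ[ℝ]} (hq : normSq q = 1) :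
    (toSO q : Matrix (Fin 3) (Fin 3) ℝ) = rotMat q := by
  rw [coe_toSO (normSq_ne_zero.1 (hq ▸ one_ne_zero)), hq, inv_one, one_smul]

theorem coe_mul_SO {n : ℕ} (A B : SO n) : ((A * B : SO n) : Matrix (Fin n) (Fin n) ℝ) =
    (A : Matrix (Fin n) (Fin n) ℝ) * (B : Matrix (Fin n) (Fin n) ℝ) := rfl

theorem coe_one_SO {n : ℕ} : ((1 : SO n) : Matrix (Fin n) (Fin n) ℝ) = 1 := rfl

theorem toSO_mul {p q : ℍ[ℝ]} (hp : p ≠ 0) (hq : q ≠ 0) : toSO (p * q) = toSO p * toSO q := by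
  refine Subtype.ext ?_
  rw [coe_mul_SO, coe_toSO hp, coe_toSO hq, coe_toSO (mul_ne_zero hp hq), rotMat_mul, map_mul,
    Matrix.smul_mul, Matrix.mul_smul, smul_smul, mul_inv]

theorem toSO_smul {c : ℝ} (hc : c ≠ 0) {q : ℍ[ℝ]} (hq : q ≠ 0) : toSO (c • q) = toSO q := by
  refine Subtype.ext ?_
  rw [coe_toSO hq, coe_toSO (smul_ne_zero hc hq), rotMat_smul, smul_smul, normSq_smul]
  congr 1
  have h : normSq q ≠ 0 := normSq_ne_zero.2 hq
  field_simp

/-- The diagonal matrix with the entry `1` at `a` and `-1` elsewhere. -/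
def halfTurnMat (a : Fin 3) : Matrix (Fin 3) (Fin 3) ℝ :=
  Matrix.diagonal fun i => if i = a then 1 else -1

/-- The rotation by `π` about a coordinate axis. -/
def halfTurn (a : Fin 3) : SO 3 :=
  ⟨halfTurnMat a, mem_SO.2 (by
    constructor
    · rw [halfTurnMat, Matrix.diagonal_transpose, Matrix.diagonal_mul_diagonal,
        ← Matrix.diagonal_one]
      congr 1
      ext i
      split_ifs <;> norm_num
    · rw [halfTurnMat, Matrix.det_diagonal]
      fin_cases a <;> simp [Fin.prod_univ_succ])⟩

theorem halfTurn_mul_self (a : Fin 3) : halfTurn a * halfTurn a = 1 := by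
  refine Subtype.ext ?_
  change halfTurnMat a * halfTurnMat a = 1
  rw [halfTurnMat, Matrix.diagonal_mul_diagonal, ← Matrix.diagonal_one]
  congr 1
  ext i
  split_ifs <;> norm_num

/-- The imaginary unit along a coordinate axis. -/
def imUnit (a : Fin 3) : ℍ[ℝ] :=
  ⟨0, if a = 0 then 1 else 0, if a = 1 then 1 else 0, if a = 2 then 1 else 0⟩

theorem normSq_imUnit (a : Fin 3) : normSq (imUnit a) = 1 := by
  rw [normSq_def']
  fin_cases a <;> simp [imUnit]

theorem imUnit_ne_zero (a : Fin 3) : imUnit a ≠ 0 :=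
  normSq_ne_zero.1 (normSq_imUnit a ▸ one_ne_zero)

theorem toSO_imUnit (a : Fin 3) : toSO (imUnit a) = halfTurn a := by
  refine Subtype.ext ?_
  rw [coe_toSO_of_normSq (normSq_imUnit a)]
  change _ = halfTurnMat a
  ext i j
  fin_cases a <;> fin_cases i <;> fin_cases j <;> simp [rotMat, imUnit, halfTurnMat]

/-- Read entrywise, this expresses each entry of a rotation as a 2 × 2 minor. These quadratic
relations, together with orthogonality, let the quaternion be recovered from the matrix. -/
theorem SO_cofactor (g : SO 3) : (g : Matrix (Fin 3) (Fin 3) ℝ).adjugate =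
    (g : Matrix (Fin 3) (Fin 3) ℝ)ᵀ := by
  obtain ⟨h1, h2⟩ := mem_SO.1 g.2
  have h3 := Matrix.adjugate_mul (g : Matrix (Fin 3) (Fin 3) ℝ)
  rw [h2, one_smul] at h3
  calc _ = (g : Matrix (Fin 3) (Fin 3) ℝ).adjugate *
        ((g : Matrix (Fin 3) (Fin 3) ℝ) * (g : Matrix (Fin 3) (Fin 3) ℝ)ᵀ) := by
          rw [h1, mul_one]
    _ = _ := by rw [← mul_assoc, h3, one_mul]

theorem exists_toSO_of_trace (g : SO 3) (hg : 1 + (g : Matrix (Fin 3) (Fin 3) ℝ).trace ≠ 0) :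
    ∃ q : ℍ[ℝ], q ≠ 0 ∧ toSO q = g := by
  obtain ⟨h1, -⟩ := mem_SO.1 g.2
  have h2 := SO_cofactor g
  have h3 : (g : Matrix (Fin 3) (Fin 3) ℝ)ᵀ * (g : Matrix (Fin 3) (Fin 3) ℝ) = 1 :=
    mul_eq_one_comm.1 h1
  obtain ⟨M, hM⟩ := g
  simp only at h1 h2 h3 hg
  -- If `M = rotMat p` with `p` a unit quaternion, these are the coordinates of `4 p.re • p`, a
  -- nonzero multiple of `p` when the trace is not `-1`.
  set q : ℍ[ℝ] := ⟨1 + M.trace, M 2 1 - M 1 2, M 0 2 - M 2 0, M 1 0 - M 0 1⟩ with hq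
  have hq0 : q ≠ 0 := fun h => hg (congrArg QuaternionAlgebra.re h)
  refine ⟨q, hq0, Subtype.ext ?_⟩
  rw [coe_toSO hq0]
  change _ = M
  rw [inv_smul_eq_iff₀ (normSq_ne_zero.2 hq0)]
  rw [Matrix.adjugate_fin_three] at h2
  have e := fun i j => congrFun (congrFun h1 i) j
  have f := fun i j => congrFun (congrFun h2 i) j
  have e' := fun i j => congrFun (congrFun h3 i) j
  simp [Fin.forall_fin_succ, Matrix.mul_apply, Fin.sum_univ_succ] at e f e'
  have hN : normSq q = 4 * (1 + M.trace) := by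
    rw [normSq_def']
    simp only [hq, Matrix.trace_fin_three]
    grind
  rw [hN]
  ext i j
  fin_cases i <;> fin_cases j <;> simp [rotMat, hq, Matrix.trace_fin_three] <;> grind

theorem exists_toSO (g : SO 3) : ∃ q : ℍ[ℝ], normSq q = 1 ∧ toSO q = g := by
  suffices h : ∃ q : ℍ[ℝ], q ≠ 0 ∧ toSO q = g by
    obtain ⟨q, hq, h⟩ := h
    have hq' : ‖q‖ ≠ 0 := norm_ne_zero_iff.2 hq
    refine ⟨‖q‖⁻¹ • q, ?_, (toSO_smul (inv_ne_zero hq') hq).trans h⟩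
    rw [normSq_smul, normSq_eq_norm_mul_self]
    field_simp
  by_cases hg : 1 + (g : Matrix (Fin 3) (Fin 3) ℝ).trace ≠ 0
  · exact exists_toSO_of_trace g hg
  -- The traces of `g` and of its three products with coordinate half turns add up to zero, so they
  -- cannot all equal `-1`.
  have : ∃ a, 1 + ((g * halfTurn a : SO 3) : Matrix (Fin 3) (Fin 3) ℝ).trace ≠ 0 := by
    by_contra! hc
    push Not at hg
    have h0 := hc 0
    have h1 := hc 1
    have h2 := hc 2
    simp only [coe_mul_SO, Matrix.trace_fin_three, halfTurn, halfTurnMat, Matrix.mul_diagonal]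
      at h0 h1 h2 hg
    simp at h0 h1 h2
    linarith
  obtain ⟨a, ha⟩ := this
  obtain ⟨q, hq, h⟩ := exists_toSO_of_trace _ ha
  refine ⟨q * imUnit a, mul_ne_zero hq (imUnit_ne_zero a), ?_⟩
  rw [toSO_mul hq (imUnit_ne_zero a), h, toSO_imUnit, mul_assoc, halfTurn_mul_self, mul_one]

end Rotations

/-! ### The rotation angle, its triangle inequality, and the chord -/

section Angle

open Quaternion Real Fl

/-- The angle in `[0, π]` of a rotation of `ℝ³`. -/
def angle (g : SO 3) : ℝ :=
  arccos (((g : Matrix (Fin 3) (Fin 3) ℝ).trace - 1) / 2)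

theorem angle_nonneg (g : SO 3) : 0 ≤ angle g := arccos_nonneg _

theorem angle_le_pi (g : SO 3) : angle g ≤ π := arccos_le_pi _

theorem angle_one : angle 1 = 0 := by
  rw [angle, coe_one_SO, Matrix.trace_one, Fintype.card_fin]
  norm_num

theorem angle_mul_comm (g h : SO 3) : angle (g * h) = angle (h * g) := by
  rw [angle, angle, coe_mul_SO, coe_mul_SO, Matrix.trace_mul_comm]

theorem angle_inv_mul_mul (g h : SO 3) : angle (h⁻¹ * g * h) = angle g := by
  rw [angle_mul_comm, ← mul_assoc, mul_inv_cancel, one_mul]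

theorem continuous_angle : Continuous angle := by
  unfold angle
  exact continuous_arccos.comp
    ((((continuous_coe 3).matrix_trace).sub continuous_const).div_const 2)

theorem sq_re_le_one {q : ℍ[ℝ]} (hq : normSq q = 1) : q.re ^ 2 ≤ 1 := by
  rw [normSq_def'] at hq
  nlinarith [sq_nonneg q.imI, sq_nonneg q.imJ, sq_nonneg q.imK]

theorem angle_toSO_eq {q : ℍ[ℝ]} (hq : q ≠ 0) :
    angle (toSO q) = arccos (2 * q.re ^ 2 / normSq q - 1) := by
  have h : normSq q ≠ 0 := normSq_ne_zero.2 hq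
  rw [angle, coe_toSO hq, Matrix.trace_smul, trace_rotMat, smul_eq_mul]
  congr 1
  field_simp
  ring

theorem arccos_two_mul_sq_sub_one {x : ℝ} (h0 : 0 ≤ x) (h1 : x ≤ 1) :
    arccos (2 * x ^ 2 - 1) = 2 * arccos x := by
  have h : 2 * x ^ 2 - 1 = cos (2 * arccos x) := by
    rw [cos_two_mul, cos_arccos (by linarith) h1]
  have h2 := arccos_le_pi_div_two.2 h0
  rw [h, arccos_cos (by linarith [arccos_nonneg x]) (by linarith)]

theorem angle_toSO {q : ℍ[ℝ]} (hq : normSq q = 1) :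
    angle (toSO q) = arccos (2 * q.re ^ 2 - 1) := by
  rw [angle_toSO_eq (normSq_ne_zero.1 (hq ▸ one_ne_zero)), hq, div_one]

theorem angle_toSO_of_nonneg {q : ℍ[ℝ]} (hq : normSq q = 1) (h : 0 ≤ q.re) :
    angle (toSO q) = 2 * arccos q.re := by
  rw [angle_toSO hq, arccos_two_mul_sq_sub_one h
    ((abs_le.1 ((sq_le_one_iff_abs_le_one _).1 (sq_re_le_one hq))).2)]

/-- Since `q` and `-q` give the same rotation, `2 arccos q.re` overshoots the angle exactly when
`q.re` is negative. -/
theorem angle_toSO_le {q : ℍ[ℝ]} (hq : normSq q = 1) :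
    angle (toSO q) ≤ 2 * arccos q.re := by
  rcases le_total 0 q.re with h | h
  · exact (angle_toSO_of_nonneg hq h).le
  · rw [angle_toSO hq, ← neg_sq, arccos_two_mul_sq_sub_one (neg_nonneg.2 h)
      ((abs_le.1 ((sq_le_one_iff_abs_le_one (-q.re)).1 (by rw [neg_sq]; exact sq_re_le_one hq))).2)]
    have := antitone_arccos (show q.re ≤ -q.re by linarith)
    linarith

theorem exists_toSO_nonneg (g : SO 3) : ∃ q : ℍ[ℝ], normSq q = 1 ∧ 0 ≤ q.re ∧ toSO q = g := by
  obtain ⟨q, hq, h⟩ := exists_toSO g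
  have hq0 : q ≠ 0 := normSq_ne_zero.1 (hq ▸ one_ne_zero)
  rcases le_total 0 q.re with h0 | h0
  · exact ⟨q, hq, h0, h⟩
  · refine ⟨(-1 : ℝ) • q, by rw [normSq_smul, hq]; norm_num, by simpa using h0, ?_⟩
    rw [toSO_smul (by norm_num) hq0, h]

theorem cos_angle (g : SO 3) :
    cos (angle g) = ((g : Matrix (Fin 3) (Fin 3) ℝ).trace - 1) / 2 := by
  obtain ⟨q, hq, rfl⟩ := exists_toSO g
  have h := sq_re_le_one hq
  rw [angle, coe_toSO_of_normSq hq, trace_rotMat, hq, cos_arccos] <;> nlinarith [sq_nonneg q.re]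

/-- This is the triangle inequality on the 3-sphere. With half-angles `α`, `β` of `p`, `q`, the real
part of `p * q` is `cos α cos β` minus the inner product of the imaginary parts. By Cauchy–Schwarz
it is at least `cos (α + β)`. -/
theorem angle_mul_le (g h : SO 3) : angle (g * h) ≤ angle g + angle h := by
  obtain ⟨p, hp, hp0, rfl⟩ := exists_toSO_nonneg g
  obtain ⟨q, hq, hq0, rfl⟩ := exists_toSO_nonneg h
  rw [← toSO_mul (normSq_ne_zero.1 (hp ▸ one_ne_zero)) (normSq_ne_zero.1 (hq ▸ one_ne_zero)),
    angle_toSO_of_nonneg hp hp0, angle_toSO_of_nonneg hq hq0]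
  refine (angle_toSO_le (by rw [map_mul, hp, hq, mul_one])).trans ?_
  rw [← mul_add]
  refine mul_le_mul_of_nonneg_left ?_ zero_le_two
  have hp1 := arccos_le_pi_div_two.2 hp0
  have hq1 := arccos_le_pi_div_two.2 hq0
  have hp2 := abs_le.1 ((sq_le_one_iff_abs_le_one _).1 (sq_re_le_one hp))
  have hq2 := abs_le.1 ((sq_le_one_iff_abs_le_one _).1 (sq_re_le_one hq))
  rw [← arccos_cos (add_nonneg (arccos_nonneg p.re) (arccos_nonneg q.re)) (by linarith)]
  refine antitone_arccos ?_
  rw [cos_add, cos_arccos hp2.1 hp2.2, cos_arccos hq2.1 hq2.2, sin_arccos, sin_arccos,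
    ← sqrt_mul (by nlinarith), re_mul]
  have key : p.imI * q.imI + p.imJ * q.imJ + p.imK * q.imK ≤
      √((1 - p.re ^ 2) * (1 - q.re ^ 2)) := by
    refine le_sqrt_of_sq_le ?_
    rw [normSq_def'] at hp hq
    rw [show 1 - p.re ^ 2 = p.imI ^ 2 + p.imJ ^ 2 + p.imK ^ 2 by linarith,
      show 1 - q.re ^ 2 = q.imI ^ 2 + q.imJ ^ 2 + q.imK ^ 2 by linarith]
    nlinarith [sq_nonneg (p.imI * q.imJ - p.imJ * q.imI), sq_nonneg (p.imI * q.imK - p.imK * q.imI),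
      sq_nonneg (p.imJ * q.imK - p.imK * q.imJ)]
  linarith

theorem tangentNorm_nonneg {n : ℕ} (X : Matrix (Fin n) (Fin n) ℝ) : 0 ≤ tangentNorm X :=
  sqrt_nonneg _

theorem tangentNorm_smul {n : ℕ} (c : ℝ) (X : Matrix (Fin n) (Fin n) ℝ) :
    tangentNorm (c • X) = |c| * tangentNorm X := by
  rw [tangentNorm, tangentNorm, Matrix.transpose_smul, Matrix.smul_mul, Matrix.mul_smul, smul_smul,
    Matrix.trace_smul, smul_eq_mul, mul_div_assoc, sqrt_mul (mul_self_nonneg c), sqrt_mul_self_eq_abs]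

theorem continuous_tangentNorm (n : ℕ) :
    Continuous fun X : Matrix (Fin n) (Fin n) ℝ => tangentNorm X := by
  unfold tangentNorm
  exact ((continuous_id.matrix_transpose.mul continuous_id).matrix_trace.div_const 2).sqrt

theorem transpose_mul_self_SO {n : ℕ} (A : SO n) :
    (A : Matrix (Fin n) (Fin n) ℝ)ᵀ * (A : Matrix (Fin n) (Fin n) ℝ) = 1 :=
  mul_eq_one_comm.1 (mem_SO.1 A.2).1

theorem tangentNorm_SO_mul {n : ℕ} (A : SO n) (X : Matrix (Fin n) (Fin n) ℝ) :
    tangentNorm ((A : Matrix (Fin n) (Fin n) ℝ) * X) = tangentNorm X := by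
  rw [tangentNorm, tangentNorm, Matrix.transpose_mul, mul_assoc, ← mul_assoc _ _ X,
    transpose_mul_self_SO, one_mul]

theorem tangentNorm_mul_SO {n : ℕ} (X : Matrix (Fin n) (Fin n) ℝ) (A : SO n) :
    tangentNorm (X * (A : Matrix (Fin n) (Fin n) ℝ)) = tangentNorm X := by
  rw [tangentNorm, tangentNorm, Matrix.transpose_mul, Matrix.trace_mul_comm, mul_assoc,
    ← mul_assoc _ _ Xᵀ, (mem_SO.1 A.2).1, one_mul, Matrix.trace_mul_comm]

/-- Two rotations at angle `θ` from each other have chord `2 sin (θ/2)` in the norm `tangentNorm`.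
This links the angle to derivatives of matrix entries. -/
theorem angle_inv_mul (g h : SO 3) :
    angle (g⁻¹ * h) = 2 * arcsin (tangentNorm
      ((h : Matrix (Fin 3) (Fin 3) ℝ) - (g : Matrix (Fin 3) (Fin 3) ℝ)) / 2) := by
  have h0 := angle_nonneg (g⁻¹ * h)
  have h1 := angle_le_pi (g⁻¹ * h)
  have hc := cos_angle (g⁻¹ * h)
  rw [coe_mul_SO, coe_inv] at hc
  have hs : 0 ≤ sin (angle (g⁻¹ * h) / 2) := sin_nonneg_of_nonneg_of_le_pi (by linarith) (by linarith)
  have key : tangentNorm ((h : Matrix (Fin 3) (Fin 3) ℝ) - (g : Matrix (Fin 3) (Fin 3) ℝ)) =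
      2 * sin (angle (g⁻¹ * h) / 2) := by
    rw [tangentNorm, ← sqrt_sq (mul_nonneg zero_le_two hs)]
    congr 1
    have ht : ((h : Matrix (Fin 3) (Fin 3) ℝ)ᵀ * (g : Matrix (Fin 3) (Fin 3) ℝ)).trace =
        ((g : Matrix (Fin 3) (Fin 3) ℝ)ᵀ * (h : Matrix (Fin 3) (Fin 3) ℝ)).trace := by
      rw [← Matrix.trace_transpose, Matrix.transpose_mul, Matrix.transpose_transpose]
    rw [mul_pow, sin_sq_eq_half_sub, mul_div_cancel₀ _ two_ne_zero, hc, Matrix.transpose_sub,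
      Matrix.sub_mul, Matrix.mul_sub, Matrix.mul_sub, transpose_mul_self_SO, transpose_mul_self_SO,
      Matrix.trace_sub, Matrix.trace_sub, Matrix.trace_sub, ht, Matrix.trace_one, Fintype.card_fin]
    push_cast
    ring
  rw [key, mul_div_cancel_left₀ _ two_ne_zero, arcsin_sin (by linarith) (by linarith)]
  ring

end Angle

/-! ### Speed and length of curves in the quotient -/

section Speed

open Quaternion Real Fl Filter

section Speed

variable {n : ℕ} {c : Composition n} {P : Finpartition (Finset.univ : Finset (Fin c.length))}
  {γ : ℝ → Fl c P} {t : ℝ} {g g' : ℝ → SO n}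

theorem proj_eq_proj {A B : SO n} : proj c P A = proj c P B ↔ A⁻¹ * B ∈ SG c P :=
  QuotientGroup.eq

theorem proj_surjective : Function.Surjective (proj c P) := QuotientGroup.mk_surjective

theorem Fl.IsLocalLift.continuousAt (h : IsLocalLift γ t g) : ContinuousAt g t := by
  refine tendsto_subtype_rng.2 ?_
  refine tendsto_pi_nhds.2 fun i => tendsto_pi_nhds.2 fun j => ?_
  exact (h.1 i j).continuousAt

theorem Fl.IsLocalLift.eventually (h : IsLocalLift γ t g) : ∀ᶠ s in 𝓝 t, IsLocalLift γ s g := by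
  have h1 : ∀ᶠ s in 𝓝 t, ∀ i j,
      ContDiffAt ℝ 1 (fun s => (g s : Matrix (Fin n) (Fin n) ℝ) i j) s :=
    eventually_all.2 fun i => eventually_all.2 fun j => (h.1 i j).eventually (by simp)
  filter_upwards [h1, h.2.eventually_nhds] with s hs hs' using ⟨hs, hs'⟩

theorem Fl.IsLocalLift.hasDerivAt (h : IsLocalLift γ t g) (i j : Fin n) :
    HasDerivAt (fun s => (g s : Matrix (Fin n) (Fin n) ℝ) i j) (velocity g t i j) t :=
  ((h.1 i j).differentiableAt one_ne_zero).hasDerivAt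

theorem Fl.IsLocalLift.continuousAt_velocity (h : IsLocalLift γ t g) :
    ContinuousAt (velocity g) t := by
  refine tendsto_pi_nhds.2 fun i => tendsto_pi_nhds.2 fun j => ?_
  have h1 := (h.1 i j).continuousAt_fderiv one_ne_zero
  exact h1.clm_apply continuousAt_const

/-- Two lifts differ by a continuous function with values in a finite group, hence locally by a
constant `k`, and right translation by `k` is an isometry. So every lift attains the infimum that
defines `speed`. -/
theorem Fl.IsLocalLift.tangentNorm_velocity_eq (hK : (SG c P : Set (SO n)).Finite)
    (h : IsLocalLift γ t g) (h' : IsLocalLift γ t g') :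
    tangentNorm (velocity g' t) = tangentNorm (velocity g t) := by
  set k := (g t)⁻¹ * g' t with hk
  have hmem : ∀ᶠ s in 𝓝 t, (g s)⁻¹ * g' s ∈ SG c P := by
    filter_upwards [h.2, h'.2] with s hs hs'
    exact proj_eq_proj.1 (hs.trans hs'.symm)
  have hcont : ContinuousAt (fun s => (g s)⁻¹ * g' s) t :=
    h.continuousAt.inv.mul h'.continuousAt
  -- The other elements of the finite group form a closed set that misses `k`.
  have hne : ∀ᶠ s in 𝓝 t, (g s)⁻¹ * g' s ∈ ((SG c P : Set (SO n)) \ {k})ᶜ :=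
    hcont.eventually_mem ((hK.subset Set.sdiff_subset).isClosed.isOpen_compl.mem_nhds
      (fun hx => hx.2 rfl))
  have heq : ∀ᶠ s in 𝓝 t, g' s = g s * k := by
    filter_upwards [hmem, hne] with s h1 h2
    have h3 : (g s)⁻¹ * g' s = k := by
      by_contra h3
      exact h2 ⟨h1, h3⟩
    rw [← h3, mul_inv_cancel_left]
  have hv : velocity g' t = velocity g t * (k : Matrix (Fin n) (Fin n) ℝ) := by
    ext i j
    have h1 : HasDerivAt (fun s => ∑ l, (g s : Matrix (Fin n) (Fin n) ℝ) i l *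
        (k : Matrix (Fin n) (Fin n) ℝ) l j)
        (∑ l, velocity g t i l * (k : Matrix (Fin n) (Fin n) ℝ) l j) t :=
      HasDerivAt.fun_sum fun l _ => (h.hasDerivAt i l).mul_const _
    rw [Matrix.mul_apply, ← h1.deriv]
    refine Filter.EventuallyEq.deriv_eq ?_
    filter_upwards [heq] with s hs
    rw [hs, coe_mul_SO, Matrix.mul_apply]
  rw [hv, tangentNorm_mul_SO]

theorem Fl.IsLocalLift.speed_eq (hK : (SG c P : Set (SO n)).Finite) (h : IsLocalLift γ t g) :
    speed γ t = ENNReal.ofReal (tangentNorm (velocity g t)) := by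
  refine le_antisymm (iInf₂_le g h) (le_iInf₂ fun g' h' => ?_)
  rw [h.tangentNorm_velocity_eq hK h']

theorem Fl.IsC1Curve.speed_ne_top (hK : (SG c P : Set (SO n)).Finite) (h : IsC1Curve γ) (t : ℝ) :
    speed γ t ≠ ⊤ := by
  obtain ⟨g, hg⟩ := h t
  rw [hg.speed_eq hK]
  exact ENNReal.ofReal_ne_top

theorem Fl.IsC1Curve.continuous_speed (hK : (SG c P : Set (SO n)).Finite) (h : IsC1Curve γ) :
    Continuous fun t => (speed γ t).toReal := by
  refine continuous_iff_continuousAt.2 fun t => ?_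
  obtain ⟨g, hg⟩ := h t
  have h1 : ContinuousAt (fun s => tangentNorm (velocity g s)) t :=
    (continuous_tangentNorm n).continuousAt.comp hg.continuousAt_velocity
  refine h1.congr ?_
  filter_upwards [hg.eventually] with s hs
  rw [hs.speed_eq hK, ENNReal.toReal_ofReal (tangentNorm_nonneg _)]

theorem Fl.IsC1Curve.length_eq (hK : (SG c P : Set (SO n)).Finite) (h : IsC1Curve γ) :
    length γ = ENNReal.ofReal (∫ t in (0 : ℝ)..1, (speed γ t).toReal) := by
  have hc := h.continuous_speed hK
  rw [length, intervalIntegral.integral_of_le zero_le_one, ← integral_Icc_eq_integral_Ioc,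
    ofReal_integral_eq_lintegral_ofReal hc.continuousOn.integrableOn_Icc
      (Eventually.of_forall fun _ => ENNReal.toReal_nonneg)]
  exact lintegral_congr fun t => (ENNReal.ofReal_toReal (h.speed_ne_top hK t)).symm

theorem Fl.IsLocalLift.tendsto_chord (h : IsLocalLift γ t g) :
    Tendsto (fun s => (s - t)⁻¹ * tangentNorm ((g s : Matrix (Fin n) (Fin n) ℝ) -
      (g t : Matrix (Fin n) (Fin n) ℝ))) (𝓝[>] t) (𝓝 (tangentNorm (velocity g t))) := by
  have h1 : Tendsto (fun s => (s - t)⁻¹ • ((g s : Matrix (Fin n) (Fin n) ℝ) -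
      (g t : Matrix (Fin n) (Fin n) ℝ))) (𝓝[>] t) (𝓝 (velocity g t)) := by
    refine tendsto_pi_nhds.2 fun i => tendsto_pi_nhds.2 fun j => ?_
    have h2 := (hasDerivAt_iff_tendsto_slope.1 (h.hasDerivAt i j)).mono_left
      (nhdsWithin_mono t fun s (hs : t < s) => hs.ne')
    exact h2
  refine (((continuous_tangentNorm n).tendsto _).comp h1).congr' ?_
  filter_upwards [self_mem_nhdsWithin] with s hs
  rw [Function.comp_apply, tangentNorm_smul, abs_of_pos (inv_pos.2 (sub_pos.2 hs))]

end Speed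

theorem Fl.IsLocalLift.tendsto_angle {c : Composition 3}
    {P : Finpartition (Finset.univ : Finset (Fin c.length))} {γ : ℝ → Fl c P} {t : ℝ}
    {g : ℝ → SO 3} (h : IsLocalLift γ t g) :
    Tendsto (fun s => (s - t)⁻¹ * angle ((g t)⁻¹ * g s)) (𝓝[>] t)
      (𝓝 (tangentNorm (velocity g t))) := by
  have hd : HasDerivAt (fun x : ℝ => 2 * arcsin (x / 2)) 1 0 := by
    have h1 : HasDerivAt arcsin 1 ((0 : ℝ) / 2) := by
      have := hasDerivAt_arcsin (x := (0 : ℝ) / 2) (by norm_num) (by norm_num)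
      simpa using this
    have h2 := ((h1.comp (0 : ℝ) ((hasDerivAt_id (0 : ℝ)).div_const 2)).const_mul 2)
    rw [show (2 * (1 * (1 / 2)) : ℝ) = 1 by norm_num] at h2
    exact h2
  -- `dslope` replaces the difference quotient because the chord may vanish for `s` arbitrarily
  -- close to `t`.
  have hds := continuousAt_dslope_same.2 hd.differentiableAt
  have hx : Tendsto (fun s => tangentNorm ((g s : Matrix (Fin 3) (Fin 3) ℝ) -
      (g t : Matrix (Fin 3) (Fin 3) ℝ))) (𝓝[>] t) (𝓝 0) := by
    have h1 : ContinuousAt (fun s => tangentNorm ((g s : Matrix (Fin 3) (Fin 3) ℝ) -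
        (g t : Matrix (Fin 3) (Fin 3) ℝ))) t :=
      (continuous_tangentNorm 3).continuousAt.comp
        (((continuous_coe 3).continuousAt.comp h.continuousAt).sub continuousAt_const)
    have h2 := h1.tendsto.mono_left (nhdsWithin_le_nhds (s := Set.Ioi t))
    rwa [sub_self, show tangentNorm (0 : Matrix (Fin 3) (Fin 3) ℝ) = 0 by simp [tangentNorm]] at h2
  have h3 := h.tendsto_chord.mul (hds.tendsto.comp hx)
  rw [dslope_same, hd.deriv, mul_one] at h3
  refine h3.congr fun s => ?_
  have h4 := sub_smul_dslope (fun x : ℝ => 2 * arcsin (x / 2)) 0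
    (tangentNorm ((g s : Matrix (Fin 3) (Fin 3) ℝ) - (g t : Matrix (Fin 3) (Fin 3) ℝ)))
  rw [angle_inv_mul, Function.comp_apply, mul_assoc]
  congr 1
  simpa using h4

/-! ### The coset angle as a lower bound for lengths -/

/-- The least angle of the elements of the coset `g {1, k}`. -/
def cosetAngle (k g : SO 3) : ℝ := min (angle g) (angle (g * k))

theorem cosetAngle_nonneg (k g : SO 3) : 0 ≤ cosetAngle k g :=
  le_min (angle_nonneg _) (angle_nonneg _)

theorem cosetAngle_one (k : SO 3) : cosetAngle k 1 = 0 :=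
  le_antisymm ((min_le_left _ _).trans angle_one.le) (cosetAngle_nonneg k 1)

theorem cosetAngle_mul_right {k : SO 3} (hk : k * k = 1) (g : SO 3) :
    cosetAngle k (g * k) = cosetAngle k g := by
  rw [cosetAngle, cosetAngle, mul_assoc, hk, mul_one, min_comm]

/-- For the second representative, `g h k = (g k)(k⁻¹ h k)`, and conjugation does not change the
angle of `h`. -/
theorem cosetAngle_mul_le (k g h : SO 3) : cosetAngle k (g * h) ≤ cosetAngle k g + angle h := by
  refine (min_le_min (angle_mul_le g h) ?_).trans (min_add_add_right _ _ _).le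
  rw [show g * h * k = g * k * (k⁻¹ * h * k) by group]
  exact (angle_mul_le _ _).trans (by rw [angle_inv_mul_mul])

theorem continuous_cosetAngle (k : SO 3) : Continuous (cosetAngle k) :=
  continuous_angle.min (continuous_angle.comp (continuous_mul_const k))

section Distance

variable {c : Composition 3} {P : Finpartition (Finset.univ : Finset (Fin c.length))} {k : SO 3}

theorem cosetAngle_eq_of_proj_eq (hk : k * k = 1) (hK : ∀ A, A ∈ SG c P ↔ A = 1 ∨ A = k)
    (B : SO 3) {A A' : SO 3} (h : proj c P A = proj c P A') :
    cosetAngle k (B * A) = cosetAngle k (B * A') := by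
  have h1 := proj_eq_proj.1 h
  obtain ⟨m, rfl⟩ : ∃ m, A' = A * m := ⟨A⁻¹ * A', by group⟩
  rw [inv_mul_cancel_left] at h1
  rcases (hK m).1 h1 with rfl | rfl
  · rw [mul_one]
  · rw [← mul_assoc, cosetAngle_mul_right hk]

/-- The coset angle from the start to `γ t` is continuous in `t`, starts at zero, and its right
difference quotients are asymptotically bounded by the speed. The comparison theorem for right
slopes then bounds it by the integral of the speed. -/
theorem cosetAngle_le_length (hk : k * k = 1) (hK : ∀ A, A ∈ SG c P ↔ A = 1 ∨ A = k)
    {γ : ℝ → Fl c P} (hγ : IsC1Curve γ) {A B : SO 3} (h0 : γ 0 = proj c P A)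
    (h1 : γ 1 = proj c P B) : ENNReal.ofReal (cosetAngle k (A⁻¹ * B)) ≤ length γ := by
  have hfin : (SG c P : Set (SO 3)).Finite := by
    refine (Set.toFinite ({1, k} : Set (SO 3))).subset fun A hA => ?_
    exact (hK A).1 hA
  rw [hγ.length_eq hfin]
  refine ENNReal.ofReal_le_ofReal ?_
  -- These representatives need no regularity: the coset angle depends only on the coset, so near
  -- each time `r` may be replaced by a `C¹` lift.
  choose r hr using fun t => proj_surjective (γ t)
  have hcs := hγ.continuous_speed hfin
  set F : ℝ → ℝ := fun t => cosetAngle k (A⁻¹ * r t) with hF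
  have hloc : ∀ {t : ℝ} {g : ℝ → SO 3}, IsLocalLift γ t g →
      F =ᶠ[𝓝 t] fun s => cosetAngle k (A⁻¹ * g s) := fun {t g} hg => by
    filter_upwards [hg.2] with s hs
    exact cosetAngle_eq_of_proj_eq hk hK _ ((hr s).trans hs.symm)
  have hcont : Continuous F := by
    refine continuous_iff_continuousAt.2 fun t => ?_
    obtain ⟨g, hg⟩ := hγ t
    refine ContinuousAt.congr ?_ (hloc hg).symm
    exact (continuous_cosetAngle k).continuousAt.comp (continuousAt_const.mul hg.continuousAt)
  have hF0 : F 0 = 0 := by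
    rw [hF]
    simp only
    rw [cosetAngle_eq_of_proj_eq hk hK _ ((hr 0).trans h0), inv_mul_cancel, cosetAngle_one]
  have hF1 : F 1 = cosetAngle k (A⁻¹ * B) :=
    cosetAngle_eq_of_proj_eq hk hK _ ((hr 1).trans h1)
  rw [← hF1]
  have hB : ∀ t, HasDerivAt (fun t => ∫ s in (0 : ℝ)..t, (speed γ s).toReal) (speed γ t).toReal t :=
    fun t => intervalIntegral.integral_hasDerivAt_right (hcs.intervalIntegrable _ _)
      hcs.stronglyMeasurable.stronglyMeasurableAtFilter hcs.continuousAt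
  refine image_le_of_liminf_slope_right_le_deriv_boundary (f := F) (a := 0) (b := 1)
    hcont.continuousOn (B := fun t => ∫ s in (0 : ℝ)..t, (speed γ s).toReal)
    (B' := fun t => (speed γ t).toReal) (by simp [hF0])
    (fun t _ => (hB t).continuousAt.continuousWithinAt) (fun t _ => (hB t).hasDerivWithinAt)
    (fun t _ r' hr' => ?_) ⟨zero_le_one, le_rfl⟩
  obtain ⟨g, hg⟩ := hγ t
  rw [hg.speed_eq hfin, ENNReal.toReal_ofReal (tangentNorm_nonneg _)] at hr'
  refine Eventually.frequently ?_
  filter_upwards [hg.tendsto_angle.eventually_lt_const hr', self_mem_nhdsWithin,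
    nhdsWithin_le_nhds (hloc hg)] with s hs hts hFs
  refine lt_of_le_of_lt ?_ hs
  rw [slope_def_module, smul_eq_mul, hFs, (hloc hg).self_of_nhds]
  refine mul_le_mul_of_nonneg_left ?_ (inv_nonneg.2 (sub_nonneg.2 (le_of_lt hts)))
  have h5 := cosetAngle_mul_le k (A⁻¹ * g t) ((g t)⁻¹ * g s)
  rw [show A⁻¹ * g t * ((g t)⁻¹ * g s) = A⁻¹ * g s by group] at h5
  linarith

end Distance

end Speed

/-! ### One-parameter subgroups and the distance formula -/

section Geodesics

open Quaternion Real Fl Filter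

/-- The matrix of the cross product with `(x, y, z)`. -/
def crossMat (x y z : ℝ) : Matrix (Fin 3) (Fin 3) ℝ :=
  !![0, -z, y; z, 0, -x; -y, x, 0]

/-- Rodrigues' formula: a unit quaternion of half-angle `a` rotates by `2 * a`. In this form the
entries are visibly smooth in the angle. -/
theorem rotMat_cos_sin {x y z : ℝ} (h : x ^ 2 + y ^ 2 + z ^ 2 = 1) (a : ℝ) :
    rotMat ⟨cos a, sin a * x, sin a * y, sin a * z⟩ =
      1 + sin (2 * a) • crossMat x y z +
        (1 - cos (2 * a)) • (crossMat x y z * crossMat x y z) := by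
  have h1 := sin_sq_add_cos_sq a
  rw [sin_two_mul, cos_two_mul']
  ext i j
  fin_cases i <;> fin_cases j <;>
    simp [rotMat, crossMat] <;> grind

theorem normSq_cos_sin {x y z : ℝ} (h : x ^ 2 + y ^ 2 + z ^ 2 = 1) (a : ℝ) :
    normSq (⟨cos a, sin a * x, sin a * y, sin a * z⟩ : ℍ[ℝ]) = 1 := by
  have h1 := sin_sq_add_cos_sq a
  refine (normSq_def' _).trans ?_
  linear_combination h1 + sin a ^ 2 * h

theorem tangentNorm_rodrigues {x y z : ℝ} (h : x ^ 2 + y ^ 2 + z ^ 2 = 1) (a : ℝ) :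
    tangentNorm (cos a • crossMat x y z + sin a • (crossMat x y z * crossMat x y z)) = 1 := by
  have h1 := sin_sq_add_cos_sq a
  rw [tangentNorm, sqrt_eq_one, Matrix.trace_fin_three]
  simp [crossMat, Matrix.mul_apply, Fin.sum_univ_succ]
  grind

theorem exists_axis (g : SO 3) : ∃ x y z : ℝ, x ^ 2 + y ^ 2 + z ^ 2 = 1 ∧
    g = toSO ⟨cos (angle g / 2), sin (angle g / 2) * x, sin (angle g / 2) * y,
      sin (angle g / 2) * z⟩ := by
  obtain ⟨q, hq, hq0, rfl⟩ := exists_toSO_nonneg g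
  have h1 := abs_le.1 ((sq_le_one_iff_abs_le_one _).1 (sq_re_le_one hq))
  rw [angle_toSO_of_nonneg hq hq0, mul_div_cancel_left₀ _ two_ne_zero, cos_arccos h1.1 h1.2]
  set s := sin (arccos q.re) with hs
  have hs2 : s ^ 2 = q.imI ^ 2 + q.imJ ^ 2 + q.imK ^ 2 := by
    rw [normSq_def'] at hq
    rw [hs, sin_sq, cos_arccos h1.1 h1.2]
    linarith
  by_cases h0 : s = 0
  -- The rotation is the identity, and any axis serves.
  · refine ⟨1, 0, 0, by norm_num, congrArg toSO ?_⟩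
    rw [h0] at hs2 ⊢
    have hI : q.imI = 0 := by nlinarith [sq_nonneg q.imI, sq_nonneg q.imJ, sq_nonneg q.imK]
    have hJ : q.imJ = 0 := by nlinarith [sq_nonneg q.imI, sq_nonneg q.imJ, sq_nonneg q.imK]
    have hK : q.imK = 0 := by nlinarith [sq_nonneg q.imI, sq_nonneg q.imJ, sq_nonneg q.imK]
    ext <;> simp [hI, hJ, hK]
  · refine ⟨q.imI / s, q.imJ / s, q.imK / s, ?_, congrArg toSO ?_⟩
    · field_simp
      exact hs2.symm
    · ext <;> simp <;> field_simp

/-- The curve `s ↦ A exp(s θ K)`, with `K` the cross product by the unit axis of `g`, has constant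
speed `θ`. -/
theorem geodesicEDist_mul_le {c : Composition 3}
    {P : Finpartition (Finset.univ : Finset (Fin c.length))} (A g : SO 3) :
    geodesicEDist (proj c P A) (proj c P (A * g)) ≤ ENNReal.ofReal (angle g) := by
  obtain ⟨x, y, z, hn, hg⟩ := exists_axis g
  set θ := angle g with hθ
  set K := crossMat x y z with hK
  set G : ℝ → SO 3 := fun s => A * toSO ⟨cos (s * θ / 2), sin (s * θ / 2) * x,
    sin (s * θ / 2) * y, sin (s * θ / 2) * z⟩ with hG
  have hcoe : ∀ s, (G s : Matrix (Fin 3) (Fin 3) ℝ) = (A : Matrix (Fin 3) (Fin 3) ℝ) +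
      sin (s * θ) • ((A : Matrix (Fin 3) (Fin 3) ℝ) * K) +
      (1 - cos (s * θ)) • ((A : Matrix (Fin 3) (Fin 3) ℝ) * (K * K)) := fun s => by
    rw [hG]
    simp only
    rw [coe_mul_SO, coe_toSO_of_normSq (normSq_cos_sin hn _), rotMat_cos_sin hn,
      mul_div_cancel₀ _ two_ne_zero, Matrix.mul_add, Matrix.mul_add, Matrix.mul_smul,
      Matrix.mul_smul, mul_one]
  have hlift : ∀ t, IsLocalLift (fun s => proj c P (G s)) t G := fun t => by
    refine ⟨fun i j => ?_, Eventually.of_forall fun _ => rfl⟩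
    simp only [hcoe, Matrix.add_apply, Matrix.smul_apply, smul_eq_mul]
    refine ContDiff.contDiffAt ?_
    fun_prop
  have hvel : ∀ t, tangentNorm (velocity G t) = θ := fun t => by
    have h1 : velocity G t = (A : Matrix (Fin 3) (Fin 3) ℝ) *
        (θ • (cos (t * θ) • K + sin (t * θ) • (K * K))) := by
      ext i j
      have hm : HasDerivAt (fun s : ℝ => s * θ) θ t := by
        simpa using (hasDerivAt_id t).mul_const θ
      have h2 := ((hm.sin.mul_const (((A : Matrix (Fin 3) (Fin 3) ℝ) * K) i j)).const_add
        ((A : Matrix (Fin 3) (Fin 3) ℝ) i j)).add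
        ((hm.cos.const_sub 1).mul_const (((A : Matrix (Fin 3) (Fin 3) ℝ) * (K * K)) i j))
      refine Eq.trans (HasDerivAt.deriv (f := fun s => (G s : Matrix (Fin 3) (Fin 3) ℝ) i j)
        (h2.congr_of_eventuallyEq (Eventually.of_forall fun s => ?_))) ?_
      · simp only [hcoe, Matrix.add_apply, Matrix.smul_apply, smul_eq_mul, Pi.add_apply]
      · rw [Matrix.mul_smul, Matrix.mul_add, Matrix.mul_smul, Matrix.mul_smul]
        simp only [Matrix.add_apply, Matrix.smul_apply, smul_eq_mul]
        ring
    rw [h1, tangentNorm_SO_mul, tangentNorm_smul, tangentNorm_rodrigues hn, mul_one,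
      abs_of_nonneg (angle_nonneg g)]
  have h0 : G 0 = A := by
    refine Subtype.ext ?_
    rw [hcoe]
    simp
  have h1 : G 1 = A * g := by
    rw [hG]
    simp only [one_mul]
    rw [← hg]
  refine (iInf₂_le (fun s => proj c P (G s)) ⟨fun t => ⟨G, hlift t⟩,
    congrArg (proj c P) h0, congrArg (proj c P) h1⟩).trans ?_
  calc length (fun s => proj c P (G s))
      ≤ ∫⁻ _ in Set.Icc (0 : ℝ) 1, ENNReal.ofReal θ :=
        lintegral_mono fun t => (iInf₂_le G (hlift t)).trans (by rw [hvel])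
    _ = ENNReal.ofReal θ := by simp

section Distance

variable {c : Composition 3} {P : Finpartition (Finset.univ : Finset (Fin c.length))} {k : SO 3}

theorem geodesicEDist_proj (hk : k * k = 1) (hK : ∀ A, A ∈ SG c P ↔ A = 1 ∨ A = k) (A B : SO 3) :
    geodesicEDist (proj c P A) (proj c P B) = ENNReal.ofReal (cosetAngle k (A⁻¹ * B)) := by
  refine le_antisymm ?_ (le_iInf₂ fun γ hγ => cosetAngle_le_length hk hK hγ.1 hγ.2.1 hγ.2.2)
  have h1 := geodesicEDist_mul_le (c := c) (P := P) A (A⁻¹ * B)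
  have h2 := geodesicEDist_mul_le (c := c) (P := P) A (A⁻¹ * B * k)
  have h3 : proj c P (B * k) = proj c P B :=
    (proj_eq_proj.2 (by rw [inv_mul_cancel_left]; exact (hK k).2 (Or.inr rfl))).symm
  rw [mul_inv_cancel_left] at h1
  rw [mul_assoc, mul_inv_cancel_left, h3] at h2
  rcases min_cases (angle (A⁻¹ * B)) (angle (A⁻¹ * B * k)) with h | h
  · rwa [cosetAngle, h.1]
  · rwa [cosetAngle, h.1, mul_assoc]

theorem geodesicDist_proj (hk : k * k = 1) (hK : ∀ A, A ∈ SG c P ↔ A = 1 ∨ A = k) (A B : SO 3) :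
    geodesicDist (proj c P A) (proj c P B) = cosetAngle k (A⁻¹ * B) := by
  rw [geodesicDist, geodesicEDist_proj hk hK, ENNReal.toReal_ofReal (cosetAngle_nonneg _ _)]

/-- The product of two open quotient maps is a quotient map, so continuity may be checked upstairs,
where the distance is explicit. -/
theorem continuous_geodesicDist (hk : k * k = 1) (hK : ∀ A, A ∈ SG c P ↔ A = 1 ∨ A = k) :
    Continuous fun p : Fl c P × Fl c P => geodesicDist p.1 p.2 := by
  have hq : IsOpenQuotientMap (proj c P) := QuotientGroup.isOpenQuotientMap_mk
  refine (hq.prodMap hq).isQuotientMap.continuous_iff.2 ?_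
  refine Continuous.congr (f := fun p : SO 3 × SO 3 => cosetAngle k (p.1⁻¹ * p.2)) ?_
    fun p => (geodesicDist_proj hk hK p.1 p.2).symm
  exact (continuous_cosetAngle k).comp (continuous_fst.inv.mul continuous_snd)

end Distance

end Geodesics

/-! ### The isotropy group of a proper partition -/

section Isotropy

/-- Some part has at least two elements because the partition is not `⊥`, and exactly two because it
is not trivial. The remaining point must then be a part by itself. -/
theorem Finpartition.exists_parts_of_card_three {α : Type*} [Fintype α] [DecidableEq α]
    (hα : Fintype.card α = 3) (P : Finpartition (Finset.univ : Finset α))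
    (h1 : P.parts ≠ {Finset.univ}) (h2 : P ≠ ⊥) :
    ∃ a : α, P.parts = {{a}, {a}ᶜ} := by
  obtain ⟨S, hS, hS2⟩ : ∃ S ∈ P.parts, 2 ≤ S.card := by
    by_contra! hc
    refine h2 (eq_bot_iff.2 fun S hS => ?_)
    have h3 := (P.nonempty_of_mem_parts hS).card_pos
    have h4 := hc S hS
    obtain ⟨x, hx⟩ := Finset.card_eq_one.1 (show S.card = 1 by omega)
    exact ⟨S, Finpartition.mem_bot_iff.2 ⟨x, Finset.mem_univ x, hx.symm⟩, le_rfl⟩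
  have huniv : S ≠ Finset.univ := by
    rintro rfl
    refine h1 (Finset.eq_singleton_iff_unique_mem.2 ⟨hS, fun T hT => ?_⟩)
    obtain ⟨x, hx⟩ := P.nonempty_of_mem_parts hT
    exact P.eq_of_mem_parts hT hS hx (Finset.mem_univ x)
  have hS3 : S.card < 3 := hα ▸ Finset.card_lt_card (Finset.ssubset_univ_iff.2 huniv)
  obtain ⟨a, ha⟩ := Finset.card_eq_one.1
    (show Sᶜ.card = 1 by rw [Finset.card_compl, hα]; omega)
  have hSa : S = {a}ᶜ := by rw [← ha, compl_compl]
  obtain ⟨T, hT, haT⟩ := P.exists_mem (Finset.mem_univ a)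
  have hTa : T = {a} := by
    refine Finset.eq_singleton_iff_unique_mem.2 ⟨haT, fun x hx => ?_⟩
    by_contra hxa
    have h3 := P.eq_of_mem_parts hT hS hx (by simpa [hSa] using hxa)
    rw [h3, hSa] at haT
    simp at haT
  refine ⟨a, Finset.Subset.antisymm (fun U hU => ?_) ?_⟩
  · obtain ⟨x, hx⟩ := P.nonempty_of_mem_parts hU
    rw [Finset.mem_insert, Finset.mem_singleton, ← hSa, ← hTa]
    by_cases hxa : x = a
    · exact Or.inl (P.eq_of_mem_parts hU hT hx (hxa ▸ haT))
    · exact Or.inr (P.eq_of_mem_parts hU hS hx (by simpa [hSa] using hxa))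
  · rw [Finset.insert_subset_iff, Finset.singleton_subset_iff, ← hSa, ← hTa]
    exact ⟨hT, hS⟩

theorem bijective_index_ones (n : ℕ) :
    Function.Bijective (Composition.ones n).index := by
  refine (Fintype.bijective_iff_injective_and_card _).2 ⟨fun i j hij => ?_, by simp⟩
  have hb : ∀ k, (Composition.ones n).blocksFun k = 1 := fun k => by simp
  have h : ∀ i : Fin n, (i : ℕ) = (Composition.ones n).sizeUpTo ((Composition.ones n).index i) := by
    intro i
    have h1 := (Composition.ones n).sizeUpTo_index_le i
    have h2 := (Composition.ones n).lt_sizeUpTo_index_succ i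
    rw [Fin.val_succ, (Composition.ones n).sizeUpTo_succ'] at h2
    rw [hb] at h2
    omega
  exact Fin.ext (by rw [h i, h j, hij])

theorem subBlock_det_of_diagonal {n : ℕ} {c : Composition n} (S : Finset (Fin c.length))
    (d : Fin n → ℝ) :
    (subBlock c S (Matrix.diagonal d)).det = ∏ i with c.index i ∈ S, d i := by
  have h : subBlock c S (Matrix.diagonal d) = Matrix.diagonal fun i => d i.1 :=
    Matrix.submatrix_diagonal d _ Subtype.val_injective
  rw [h, Matrix.det_diagonal]
  exact (Finset.prod_subtype _ (by simp) d).symm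

/-- Orthogonal diagonal matrices have entries `±1`. The entry at `a` is `1`, so determinant one
forces a common sign on the other two. -/
theorem mem_SG_iff (P : Finpartition (Finset.univ : Finset (Fin (Composition.ones 3).length)))
    (a : Fin 3) (hP : P.parts = {{(Composition.ones 3).index a}, {(Composition.ones 3).index a}ᶜ})
    (A : SO 3) : A ∈ SG (Composition.ones 3) P ↔ A = 1 ∨ A = halfTurn a := by
  have hinj := (bijective_index_ones 3).injective
  have hf : (Finset.univ.filter fun i => (Composition.ones 3).index i ∈
      ({(Composition.ones 3).index a} : Finset _)) = {a} := by
    ext i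
    simp [hinj.eq_iff]
  have hf' : (Finset.univ.filter fun i => (Composition.ones 3).index i ∈
      ({(Composition.ones 3).index a} : Finset _)ᶜ) = {a}ᶜ := by
    ext i
    simp [hinj.eq_iff]
  constructor
  · rintro ⟨h1, h2⟩
    have hd : (A : Matrix (Fin 3) (Fin 3) ℝ) =
        Matrix.diagonal fun i => (A : Matrix (Fin 3) (Fin 3) ℝ) i i := by
      ext i j
      by_cases hij : i = j
      · rw [hij, Matrix.diagonal_apply_eq]
      · rw [Matrix.diagonal_apply_ne _ hij, h1 i j (hinj.ne hij)]
    have h3 := h2 {(Composition.ones 3).index a} (by rw [hP]; simp)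
    rw [hd, subBlock_det_of_diagonal, hf, Finset.prod_singleton] at h3
    obtain ⟨ho, hdet⟩ := mem_SO.1 A.2
    rw [hd, Matrix.det_diagonal] at hdet
    rw [hd, Matrix.diagonal_transpose, Matrix.diagonal_mul_diagonal] at ho
    have hsq : ∀ i, (A : Matrix (Fin 3) (Fin 3) ℝ) i i = 1 ∨
        (A : Matrix (Fin 3) (Fin 3) ℝ) i i = -1 := fun i => by
      have h4 := congrFun (congrFun ho i) i
      rw [Matrix.diagonal_apply_eq, Matrix.one_apply_eq] at h4
      exact mul_self_eq_one_iff.1 h4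
    have hext : ∀ {B : SO 3} (d : Fin 3 → ℝ), (B : Matrix (Fin 3) (Fin 3) ℝ) = Matrix.diagonal d →
        (∀ i, (A : Matrix (Fin 3) (Fin 3) ℝ) i i = d i) → A = B := by
      intro B d hB hi
      refine Subtype.ext ?_
      rw [hd, hB]
      congr 1
      ext i
      exact hi i
    rw [Fin.prod_univ_three] at hdet
    have e1 := hext (B := 1) (fun _ => 1) (coe_one_SO.trans Matrix.diagonal_one.symm)
    have e2 := hext (B := halfTurn a) _ rfl
    simp only [Fin.forall_fin_succ, Fin.succ_zero_eq_one, Fin.succ_one_eq_two, IsEmpty.forall_iff,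
      and_true] at e1 e2
    have s0 := hsq 0
    have s1 := hsq 1
    have s2 := hsq 2
    clear hsq hext hd h1 h2 ho hf hf' hP
    fin_cases a <;> simp at h3 e2 <;> grind
  · rintro (rfl | rfl)
    · exact one_mem _
    · refine ⟨fun i j hij => Matrix.diagonal_apply_ne _ fun h => hij (h ▸ rfl), fun S hS => ?_⟩
      change (subBlock _ S (halfTurnMat a)).det = 1
      rw [halfTurnMat, subBlock_det_of_diagonal]
      rw [hP, Finset.mem_insert, Finset.mem_singleton] at hS
      rcases hS with rfl | rfl
      · rw [hf, Finset.prod_singleton, if_pos rfl]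
      · have h1 := (mem_SO.1 (halfTurn a).2).2
        change (halfTurnMat a).det = 1 at h1
        rw [halfTurnMat, Matrix.det_diagonal, ← Finset.prod_mul_prod_compl {a},
          Finset.prod_singleton, if_pos rfl, one_mul] at h1
        rw [hf', h1]

theorem exists_mem_SG_iff
    (P : Finpartition (Finset.univ : Finset (Fin (Composition.ones 3).length)))
    (hP : IsProperPartition P) :
    ∃ a : Fin 3, ∀ A, A ∈ SG (Composition.ones 3) P ↔ A = 1 ∨ A = halfTurn a := by
  obtain ⟨b, hb⟩ := Finpartition.exists_parts_of_card_three (by simp) P hP.1 hP.2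
  obtain ⟨a, rfl⟩ := (bijective_index_ones 3).surjective b
  exact ⟨a, mem_SG_iff P a hb⟩

end Isotropy

/-! ### Haar measure from Lebesgue measure on the quaternion ball -/

section Haar

open Quaternion Filter

/-- The real quaternions as pairs of points of the plane. The first plane is spanned by `1` and
the imaginary unit of index `a`. -/
def quatEquiv (a : Fin 3) : ((ℝ × ℝ) × (ℝ × ℝ)) ≃ₗ[ℝ] ℍ[ℝ] where
  toFun v := ⟨v.1.1, ![v.1.2, v.2.1, v.2.2] (0 - a), ![v.1.2, v.2.1, v.2.2] (1 - a),
    ![v.1.2, v.2.1, v.2.2] (2 - a)⟩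
  invFun q := ((q.re, ![q.imI, q.imJ, q.imK] a),
    (![q.imI, q.imJ, q.imK] (a + 1), ![q.imI, q.imJ, q.imK] (a + 2)))
  map_add' v w := by fin_cases a <;> rfl
  map_smul' r v := by fin_cases a <;> ext <;> rfl
  left_inv v := by fin_cases a <;> rfl
  right_inv q := by fin_cases a <;> rfl

theorem re_quatEquiv (a : Fin 3) (v : (ℝ × ℝ) × (ℝ × ℝ)) : (quatEquiv a v).re = v.1.1 := rfl

theorem imI_quatEquiv (a : Fin 3) (v : (ℝ × ℝ) × (ℝ × ℝ)) :
    (quatEquiv a v).imI = ![v.1.2, v.2.1, v.2.2] (0 - a) := rfl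

theorem imJ_quatEquiv (a : Fin 3) (v : (ℝ × ℝ) × (ℝ × ℝ)) :
    (quatEquiv a v).imJ = ![v.1.2, v.2.1, v.2.2] (1 - a) := rfl

theorem imK_quatEquiv (a : Fin 3) (v : (ℝ × ℝ) × (ℝ × ℝ)) :
    (quatEquiv a v).imK = ![v.1.2, v.2.1, v.2.2] (2 - a) := rfl

/-- The squared Euclidean norm. -/
def sqNorm (v : (ℝ × ℝ) × (ℝ × ℝ)) : ℝ := v.1.1 ^ 2 + v.1.2 ^ 2 + (v.2.1 ^ 2 + v.2.2 ^ 2)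

theorem continuous_sqNorm : Continuous sqNorm := by
  unfold sqNorm
  fun_prop

theorem normSq_quatEquiv (a : Fin 3) (v : (ℝ × ℝ) × (ℝ × ℝ)) :
    normSq (quatEquiv a v) = sqNorm v := by
  rw [normSq_def', sqNorm, re_quatEquiv, imI_quatEquiv, imJ_quatEquiv, imK_quatEquiv]
  fin_cases a <;> simp <;> ring

/-- The index shift in `quatEquiv` is modulo 3 and puts `v.1.2` on axis `a`. Hence the angles of
both coset elements are governed by the first plane alone, for every `a`. -/
theorem re_quatEquiv_mul_imUnit (a : Fin 3) (v : (ℝ × ℝ) × (ℝ × ℝ)) :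
    (quatEquiv a v * imUnit a).re = -v.1.2 := by
  rw [re_mul, imI_quatEquiv, imJ_quatEquiv, imK_quatEquiv]
  fin_cases a <;> simp [imUnit]

instance isAddHaarMeasure_volume_plane : (volume : Measure (ℝ × ℝ)).IsAddHaarMeasure :=
  inferInstanceAs ((volume : Measure ℝ).prod (volume : Measure ℝ)).IsAddHaarMeasure

instance isAddHaarMeasure_volume_planes :
    (volume : Measure ((ℝ × ℝ) × (ℝ × ℝ))).IsAddHaarMeasure :=
  inferInstanceAs ((volume : Measure (ℝ × ℝ)).prod (volume : Measure (ℝ × ℝ))).IsAddHaarMeasure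

/-- The open unit ball. -/
def unitBall : Set ((ℝ × ℝ) × (ℝ × ℝ)) := {v | sqNorm v < 1}

theorem isOpen_unitBall : IsOpen unitBall := isOpen_lt continuous_sqNorm continuous_const

theorem volume_unitBall_ne_zero : volume unitBall ≠ 0 :=
  (isOpen_unitBall.measure_pos volume ⟨0, by simp [unitBall, sqNorm]⟩).ne'

theorem volume_unitBall_ne_top : volume unitBall ≠ ⊤ := by
  refine ne_top_of_le_ne_top (measure_closedBall_lt_top (x := 0) (r := 1)).ne (measure_mono ?_)
  intro v hv
  have hv' : v.1.1 ^ 2 + v.1.2 ^ 2 + (v.2.1 ^ 2 + v.2.2 ^ 2) < 1 := hv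
  rw [mem_closedBall_zero_iff, Prod.norm_def, Prod.norm_def, Prod.norm_def]
  simp only [Real.norm_eq_abs, max_le_iff, ← sq_le_one_iff_abs_le_one]
  refine ⟨⟨?_, ?_⟩, ?_, ?_⟩ <;>
    nlinarith [sq_nonneg v.1.1, sq_nonneg v.1.2, sq_nonneg v.2.1, sq_nonneg v.2.2]

theorem continuousAt_toSO_quatEquiv (a : Fin 3) {v : (ℝ × ℝ) × (ℝ × ℝ)} (hv : v ≠ 0) :
    ContinuousAt (fun v => toSO (quatEquiv a v)) v := by
  refine tendsto_subtype_rng.2 ?_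
  have hN : sqNorm v ≠ 0 := by
    rw [← normSq_quatEquiv a]
    exact normSq_ne_zero.2 ((quatEquiv a).map_ne_zero_iff.2 hv)
  have h1 : Continuous fun v => rotMat (quatEquiv a v) := by
    refine continuous_matrix fun i j => ?_
    fin_cases a <;> fin_cases i <;> fin_cases j <;> 
      simp [rotMat, re_quatEquiv, imI_quatEquiv, imJ_quatEquiv, imK_quatEquiv] <;> fun_prop
  have h2 : ContinuousAt (fun v => (sqNorm v)⁻¹ • rotMat (quatEquiv a v)) v :=
    (continuous_sqNorm.continuousAt.inv₀ hN).smul h1.continuousAt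
  have he : (fun v => (sqNorm v)⁻¹ • rotMat (quatEquiv a v)) =ᶠ[𝓝 v]
      fun v => (toSO (quatEquiv a v) : Matrix (Fin 3) (Fin 3) ℝ) := by
    filter_upwards [isOpen_ne.mem_nhds hv] with w hw
    rw [coe_toSO ((quatEquiv a).map_ne_zero_iff.2 hw), normSq_quatEquiv]
  exact (h2.congr he).tendsto

theorem measurable_toSO_quatEquiv (a : Fin 3) : Measurable fun v => toSO (quatEquiv a v) :=
  measurable_of_continuousOn_compl_singleton 0
    fun _ hv => (continuousAt_toSO_quatEquiv a hv).continuousWithinAt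

/-- Left multiplication by a quaternion. -/
def quatMul (a : Fin 3) (p : ℍ[ℝ]) : ((ℝ × ℝ) × (ℝ × ℝ)) →ₗ[ℝ] ((ℝ × ℝ) × (ℝ × ℝ)) :=
  (quatEquiv a).symm.toLinearMap ∘ₗ LinearMap.mulLeft ℝ p ∘ₗ (quatEquiv a).toLinearMap

theorem quatEquiv_quatMul (a : Fin 3) (p : ℍ[ℝ]) (v : (ℝ × ℝ) × (ℝ × ℝ)) :
    quatEquiv a (quatMul a p v) = p * quatEquiv a v :=
  (quatEquiv a).apply_symm_apply _

theorem sqNorm_quatMul (a : Fin 3) {p : ℍ[ℝ]} (hp : normSq p = 1) (v : (ℝ × ℝ) × (ℝ × ℝ)) :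
    sqNorm (quatMul a p v) = sqNorm v := by
  rw [← normSq_quatEquiv a, quatEquiv_quatMul, map_mul, hp, one_mul, normSq_quatEquiv]

theorem det_quatMul_ne_zero (a : Fin 3) {p : ℍ[ℝ]} (hp : normSq p = 1) :
    LinearMap.det (quatMul a p) ≠ 0 := by
  have h : quatMul a p ∘ₗ quatMul a (star p) = LinearMap.id := by
    refine LinearMap.ext fun v => (quatEquiv a).injective ?_
    rw [LinearMap.comp_apply, quatEquiv_quatMul, quatEquiv_quatMul, ← mul_assoc, self_mul_star, hp]
    simp
  have h2 := congrArg LinearMap.det h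
  rw [LinearMap.det_comp, LinearMap.det_id] at h2
  exact left_ne_zero_of_mul_eq_one h2

/-- An invertible linear map scales volume by a constant. This one preserves the unit ball, so the
constant is one and the determinant need not be computed. -/
theorem measurePreserving_quatMul (a : Fin 3) {p : ℍ[ℝ]} (hp : normSq p = 1) :
    MeasurePreserving (quatMul a p) := by
  have hm : Measurable (quatMul a p) := (quatMul a p).continuous_of_finiteDimensional.measurable
  refine ⟨hm, ?_⟩
  have h := Measure.map_linearMap_addHaar_eq_smul_addHaar
    (volume : Measure ((ℝ × ℝ) × (ℝ × ℝ))) (det_quatMul_ne_zero a hp)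
  have hpre : quatMul a p ⁻¹' unitBall = unitBall := by
    ext v
    simp only [unitBall, Set.mem_preimage, Set.mem_ofPred_eq, sqNorm_quatMul a hp]
  have h2 := congrArg (fun m => m unitBall) h
  simp only [Measure.map_apply hm isOpen_unitBall.measurableSet, hpre, Measure.smul_apply,
    smul_eq_mul] at h2
  have h3 := ENNReal.eq_div_iff volume_unitBall_ne_zero volume_unitBall_ne_top |>.2
    ((mul_comm _ _).trans h2.symm)
  rw [ENNReal.div_self volume_unitBall_ne_zero volume_unitBall_ne_top] at h3
  rw [h, h3, one_smul]

instance isHaarMeasure_haarSO (n : ℕ) : (haarSO n).IsHaarMeasure :=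
  inferInstanceAs (Measure.haarMeasure ⊤).IsHaarMeasure

instance isProbabilityMeasure_haarSO (n : ℕ) : IsProbabilityMeasure (haarSO n) :=
  ⟨Measure.haarMeasure_self (K₀ := (⊤ : TopologicalSpace.PositiveCompacts (SO n)))⟩

instance secondCountableTopology_SO (n : ℕ) : SecondCountableTopology (SO n) :=
  have : SecondCountableTopology (Matrix (Fin n) (Fin n) ℝ) :=
    inferInstanceAs (SecondCountableTopology (Fin n → Fin n → ℝ))
  TopologicalSpace.Subtype.secondCountableTopology _

theorem ae_ne_zero : ∀ᵐ v : (ℝ × ℝ) × (ℝ × ℝ), v ≠ 0 := by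
  have h2 : NullSingletonClass (volume : Measure (ℝ × ℝ)) :=
    Measure.prod.instNullSingletonClass_fst
  have h3 : NullSingletonClass (volume : Measure ((ℝ × ℝ) × (ℝ × ℝ))) :=
    Measure.prod.instNullSingletonClass_fst
  exact Measure.ae_ne volume 0

theorem isMulLeftInvariant_map_toSO (a : Fin 3) :
    ((volume.restrict unitBall).map fun v => toSO (quatEquiv a v)).IsMulLeftInvariant := by
  have hm := measurable_toSO_quatEquiv a
  refine ⟨fun g => ?_⟩
  obtain ⟨p, hp, rfl⟩ := exists_toSO g
  have hp0 : p ≠ 0 := normSq_ne_zero.1 (hp ▸ one_ne_zero)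
  have h1 : MeasurePreserving (quatMul a p) (volume.restrict unitBall)
      (volume.restrict unitBall) := by
    have := (measurePreserving_quatMul a hp).restrict_preimage isOpen_unitBall.measurableSet
    rwa [show quatMul a p ⁻¹' unitBall = unitBall by
      ext v
      simp only [unitBall, Set.mem_preimage, Set.mem_ofPred_eq, sqNorm_quatMul a hp]] at this
  rw [Measure.map_map (measurable_const_mul _) hm]
  conv_rhs => rw [← h1.map_eq, Measure.map_map hm h1.measurable]
  refine Measure.map_congr ?_
  have h0 : ∀ᵐ v ∂(volume : Measure ((ℝ × ℝ) × (ℝ × ℝ))).restrict unitBall, v ≠ 0 :=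
    ae_restrict_of_ae ae_ne_zero
  filter_upwards [h0] with v hv
  rw [Function.comp_apply, Function.comp_apply, quatEquiv_quatMul,
    toSO_mul hp0 ((quatEquiv a).map_ne_zero_iff.2 hv)]

/-- The image of Lebesgue measure on the ball is left invariant, hence a multiple of Haar measure.
The total mass identifies the factor as the volume of the ball. -/
theorem lintegral_haarSO (a : Fin 3) {F : SO 3 → ℝ≥0∞} (hF : Measurable F) :
    (∫⁻ g, F g ∂haarSO 3) * volume unitBall = ∫⁻ v in unitBall, F (toSO (quatEquiv a v)) := by
  have hm := measurable_toSO_quatEquiv a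
  have := isMulLeftInvariant_map_toSO a
  have : IsFiniteMeasure ((volume : Measure ((ℝ × ℝ) × (ℝ × ℝ))).restrict unitBall) :=
    ⟨by rw [Measure.restrict_apply_univ]; exact volume_unitBall_ne_top.lt_top⟩
  have h := Measure.isMulLeftInvariant_eq_smul
    ((volume.restrict unitBall).map fun v => toSO (quatEquiv a v)) (haarSO 3)
  set r := Measure.haarScalarFactor
    ((volume.restrict unitBall).map fun v => toSO (quatEquiv a v)) (haarSO 3)
  have h1 := congrArg (fun m => m Set.univ) h
  simp only [Measure.map_apply hm MeasurableSet.univ, Set.preimage_univ,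
    Measure.restrict_apply_univ, Measure.smul_apply, measure_univ] at h1
  rw [← lintegral_map hF hm, h, h1, lintegral_smul_measure]
  simp [ENNReal.smul_def, mul_comm]

end Haar

/-! ### Polar coordinates in two orthogonal planes -/

section PolarCoordinates

open Set Real

theorem lintegral_polar {f : ℝ × ℝ → ℝ≥0∞} (hf : Measurable f) :
    ∫⁻ p, f p = ∫⁻ r in Ioi (0 : ℝ), ∫⁻ φ in Ioo (-π) π,
      ENNReal.ofReal r * f (r * cos φ, r * sin φ) := by
  rw [← lintegral_comp_polarCoord_symm, polarCoord_target, Measure.volume_eq_prod,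
    ← Measure.prod_restrict, lintegral_prod]
  · rfl
  · have h : Measurable fun p : ℝ × ℝ => polarCoord.symm p := by
      simp only [polarCoord_symm_apply]
      fun_prop
    exact (measurable_fst.ennreal_ofReal.mul (hf.comp h)).aemeasurable

theorem cos_sin_pos_iff {χ : ℝ} (h : χ ∈ Ioo (-π) π) :
    (0 < cos χ ∧ 0 < sin χ) ↔ χ ∈ Ioo 0 (π / 2) := by
  constructor
  · rintro ⟨hc, hs⟩
    have h0 : 0 < χ := by
      by_contra! h0
      exact absurd hs (not_lt.2 (sin_nonpos_of_nonpos_of_neg_pi_le h0 h.1.le))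
    refine ⟨h0, ?_⟩
    by_contra! h1
    exact absurd hc (not_lt.2 (cos_nonpos_of_pi_div_two_le_of_le h1 (by linarith [h.2, pi_pos])))
  · rintro ⟨h0, h1⟩
    exact ⟨cos_pos_of_mem_Ioo ⟨by linarith, h1⟩, sin_pos_of_pos_of_lt_pi h0 h.2⟩

/-- Substitute `r = ρ cos χ`, `s = ρ sin χ`. The weight `r s` and the Jacobian `ρ` give `ρ³ cos χ
sin χ`, while `r²/(r² + s²)` becomes `cos² χ`. -/
theorem lintegral_quadrant {k : ℝ → ℝ≥0∞} (hk : Measurable k) :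
    ∫⁻ r in Ioi (0 : ℝ), ∫⁻ s in Ioi (0 : ℝ),
      ENNReal.ofReal r * (ENNReal.ofReal s *
        (Iio (1 : ℝ)).indicator (fun _ => k (r ^ 2 / (r ^ 2 + s ^ 2))) (r ^ 2 + s ^ 2)) =
    (∫⁻ ρ in Ioo (0 : ℝ) 1, ENNReal.ofReal (ρ ^ 3)) *
      ∫⁻ χ in Ioo 0 (π / 2), ENNReal.ofReal (cos χ * sin χ) * k (cos χ ^ 2) := by
  have hm : Measurable fun p : ℝ × ℝ => ENNReal.ofReal p.1 * (ENNReal.ofReal p.2 *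
      (Iio (1 : ℝ)).indicator (fun _ => k (p.1 ^ 2 / (p.1 ^ 2 + p.2 ^ 2)))
        (p.1 ^ 2 + p.2 ^ 2)) := by
    refine measurable_fst.ennreal_ofReal.mul (measurable_snd.ennreal_ofReal.mul ?_)
    have h1 : MeasurableSet {p : ℝ × ℝ | p.1 ^ 2 + p.2 ^ 2 < 1} :=
      measurableSet_lt (by fun_prop) measurable_const
    have h2 : Measurable fun p : ℝ × ℝ => k (p.1 ^ 2 / (p.1 ^ 2 + p.2 ^ 2)) :=
      hk.comp (by fun_prop)
    exact h2.indicator h1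
  have hq : MeasurableSet (Ioi (0 : ℝ) ×ˢ Ioi (0 : ℝ)) := measurableSet_Ioi.prod measurableSet_Ioi
  have h1 := lintegral_prod (μ := volume.restrict (Ioi (0 : ℝ))) (ν := volume.restrict (Ioi (0 : ℝ)))
    _ hm.aemeasurable
  rw [Measure.prod_restrict, ← Measure.volume_eq_prod, ← lintegral_indicator hq,
    lintegral_polar (hm.indicator hq)] at h1
  refine h1.symm.trans ?_
  have hg : Measurable fun χ : ℝ => ENNReal.ofReal (cos χ * sin χ) * k (cos χ ^ 2) :=
    (by fun_prop : Measurable fun χ : ℝ => ENNReal.ofReal (cos χ * sin χ)).mul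
      (hk.comp (by fun_prop))
  have h2 : ∀ r ∈ Ioi (0 : ℝ), (∫⁻ φ in Ioo (-π) π, ENNReal.ofReal r *
      (Ioi (0 : ℝ) ×ˢ Ioi (0 : ℝ)).indicator (fun p : ℝ × ℝ => ENNReal.ofReal p.1 *
        (ENNReal.ofReal p.2 * (Iio (1 : ℝ)).indicator
          (fun _ => k (p.1 ^ 2 / (p.1 ^ 2 + p.2 ^ 2))) (p.1 ^ 2 + p.2 ^ 2)))
        (r * cos φ, r * sin φ)) =
      (Iio (1 : ℝ)).indicator (fun ρ => ENNReal.ofReal (ρ ^ 3)) r *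
        ∫⁻ χ in Ioo 0 (π / 2), ENNReal.ofReal (cos χ * sin χ) * k (cos χ ^ 2) := by
    intro r hr
    have hr0 : 0 < r := hr
    have h3 : Ioo 0 (π / 2) = Ioo 0 (π / 2) ∩ Ioo (-π) π :=
      (inter_eq_left.2 (Ioo_subset_Ioo (by linarith [pi_pos]) (by linarith [pi_pos]))).symm
    rw [h3, ← setLIntegral_indicator measurableSet_Ioo, ← lintegral_const_mul _
      (hg.indicator measurableSet_Ioo)]
    refine setLIntegral_congr_fun measurableSet_Ioo fun φ hφ => ?_
    by_cases hφ' : φ ∈ Ioo 0 (π / 2)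
    · obtain ⟨hc, hs⟩ := (cos_sin_pos_iff hφ).2 hφ'
      have hmem : (r * cos φ, r * sin φ) ∈ Ioi (0 : ℝ) ×ˢ Ioi (0 : ℝ) :=
        ⟨mul_pos hr0 hc, mul_pos hr0 hs⟩
      have hsq : (r * cos φ) ^ 2 + (r * sin φ) ^ 2 = r ^ 2 := by
        linear_combination r ^ 2 * sin_sq_add_cos_sq φ
      rw [indicator_of_mem hmem, indicator_of_mem hφ']
      simp only [hsq]
      rw [show (r * cos φ) ^ 2 / r ^ 2 = cos φ ^ 2 by field_simp]
      by_cases hr1 : r < 1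
      · rw [indicator_of_mem (show r ^ 2 ∈ Iio 1 from pow_lt_one₀ hr0.le hr1 two_ne_zero),
          indicator_of_mem (show r ∈ Iio 1 from hr1), ← mul_assoc, ← mul_assoc, ← mul_assoc,
          ← ENNReal.ofReal_mul hr0.le, ← ENNReal.ofReal_mul (mul_pos hr0 (mul_pos hr0 hc)).le,
          ← ENNReal.ofReal_mul (pow_pos hr0 3).le]
        congr 2
        ring
      · rw [indicator_of_notMem (show r ∉ Iio 1 from hr1), indicator_of_notMem
          (show r ^ 2 ∉ Iio 1 from not_lt.2 (one_le_pow₀ (not_lt.1 hr1)))]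
        simp
    · have hmem : (r * cos φ, r * sin φ) ∉ Ioi (0 : ℝ) ×ˢ Ioi (0 : ℝ) := fun hm =>
        hφ' ((cos_sin_pos_iff hφ).1 ⟨pos_of_mul_pos_right hm.1 hr0.le,
          pos_of_mul_pos_right hm.2 hr0.le⟩)
      rw [indicator_of_notMem hmem, indicator_of_notMem hφ', mul_zero, mul_zero]
  rw [setLIntegral_congr_fun measurableSet_Ioi h2, lintegral_mul_const _
    ((by fun_prop : Measurable fun ρ : ℝ => ENNReal.ofReal (ρ ^ 3)).indicator measurableSet_Iio),
    setLIntegral_indicator measurableSet_Iio, Iio_inter_Ioi]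

/-- The integrand does not see the angle `ψ` of the second plane, whence the factor `2π`. The radial
factor stays unevaluated because it cancels against the volume of the ball. -/
theorem lintegral_unitBall_eq {h : (ℝ × ℝ) × (ℝ × ℝ) → ℝ≥0∞} (hh : Measurable h)
    {k : ℝ → ℝ → ℝ≥0∞} (hk : Measurable (Function.uncurry k))
    (hhk : ∀ r φ s ψ : ℝ, 0 < r → 0 < s →
      h ((r * cos φ, r * sin φ), (s * cos ψ, s * sin ψ)) = k φ (r ^ 2 / (r ^ 2 + s ^ 2))) :
    ∫⁻ v in unitBall, h v = ENNReal.ofReal (2 * π) *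
      (∫⁻ ρ in Ioo (0 : ℝ) 1, ENNReal.ofReal (ρ ^ 3)) * ∫⁻ φ in Ioo (-π) π,
      ∫⁻ χ in Ioo 0 (π / 2), ENNReal.ofReal (cos χ * sin χ) * k φ (cos χ ^ 2) := by
  have hi : Measurable (unitBall.indicator h) := hh.indicator isOpen_unitBall.measurableSet
  rw [← lintegral_indicator isOpen_unitBall.measurableSet, Measure.volume_eq_prod,
    lintegral_prod _ hi.aemeasurable, lintegral_polar (Measurable.lintegral_prod_right' hi)]
  have h1 : ∀ r ∈ Ioi (0 : ℝ), ∀ φ : ℝ,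
      (∫⁻ q : ℝ × ℝ, unitBall.indicator h ((r * cos φ, r * sin φ), q)) =
      ENNReal.ofReal (2 * π) * ∫⁻ s in Ioi (0 : ℝ), ENNReal.ofReal s *
        (Iio (1 : ℝ)).indicator (fun _ => k φ (r ^ 2 / (r ^ 2 + s ^ 2))) (r ^ 2 + s ^ 2) := by
    intro r hr φ
    have hr0 : 0 < r := hr
    have hm : Measurable fun q : ℝ × ℝ => unitBall.indicator h ((r * cos φ, r * sin φ), q) :=
      hi.comp (by fun_prop)
    have hk' : Measurable fun s : ℝ => ENNReal.ofReal s *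
        (Iio (1 : ℝ)).indicator (fun _ => k φ (r ^ 2 / (r ^ 2 + s ^ 2))) (r ^ 2 + s ^ 2) := by
      have h1 : MeasurableSet {s : ℝ | r ^ 2 + s ^ 2 < 1} :=
        measurableSet_lt (by fun_prop) measurable_const
      have h2 : Measurable fun s : ℝ => k φ (r ^ 2 / (r ^ 2 + s ^ 2)) :=
        hk.comp (f := fun s : ℝ => (φ, r ^ 2 / (r ^ 2 + s ^ 2))) (by fun_prop)
      exact (by fun_prop : Measurable fun s : ℝ => ENNReal.ofReal s).mul (h2.indicator h1)
    rw [lintegral_polar hm, ← lintegral_const_mul _ hk']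
    refine setLIntegral_congr_fun measurableSet_Ioi fun s hs => ?_
    have hN : ∀ ψ, sqNorm ((r * cos φ, r * sin φ), (s * cos ψ, s * sin ψ)) = r ^ 2 + s ^ 2 :=
      fun ψ => by
        simp only [sqNorm]
        linear_combination r ^ 2 * sin_sq_add_cos_sq φ + s ^ 2 * sin_sq_add_cos_sq ψ
    have h3 : ∀ ψ, unitBall.indicator h ((r * cos φ, r * sin φ), (s * cos ψ, s * sin ψ)) =
        (Iio (1 : ℝ)).indicator (fun _ => k φ (r ^ 2 / (r ^ 2 + s ^ 2))) (r ^ 2 + s ^ 2) :=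
      fun ψ => by
        by_cases hlt : r ^ 2 + s ^ 2 < 1
        · rw [indicator_of_mem (show r ^ 2 + s ^ 2 ∈ Iio 1 from hlt), indicator_of_mem
            (show _ ∈ unitBall from (hN ψ).trans_lt hlt), hhk r φ s ψ hr0 hs]
        · rw [indicator_of_notMem (show r ^ 2 + s ^ 2 ∉ Iio 1 from hlt), indicator_of_notMem
            (show _ ∉ unitBall from fun hmem => hlt ((hN ψ).symm.trans_lt hmem))]
    simp only [h3]
    rw [setLIntegral_const, Real.volume_Ioo, mul_comm]
    congr 2
    ring
  have h2 : ∀ r ∈ Ioi (0 : ℝ), (∫⁻ φ in Ioo (-π) π, ENNReal.ofReal r *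
      ∫⁻ q : ℝ × ℝ, unitBall.indicator h ((r * cos φ, r * sin φ), q)) =
      ∫⁻ φ in Ioo (-π) π, ENNReal.ofReal (2 * π) * ∫⁻ s in Ioi (0 : ℝ), ENNReal.ofReal r *
        (ENNReal.ofReal s * (Iio (1 : ℝ)).indicator
          (fun _ => k φ (r ^ 2 / (r ^ 2 + s ^ 2))) (r ^ 2 + s ^ 2)) := fun r hr => by
    refine lintegral_congr fun φ => ?_
    rw [h1 r hr φ, lintegral_const_mul' _ _ ENNReal.ofReal_ne_top]
    ring
  have hmeas : Measurable fun p : (ℝ × ℝ) × ℝ => ENNReal.ofReal p.1.1 *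
        (ENNReal.ofReal p.2 * (Iio (1 : ℝ)).indicator
          (fun _ => k p.1.2 (p.1.1 ^ 2 / (p.1.1 ^ 2 + p.2 ^ 2))) (p.1.1 ^ 2 + p.2 ^ 2)) := by
    have h1 : MeasurableSet {p : (ℝ × ℝ) × ℝ | p.1.1 ^ 2 + p.2 ^ 2 < 1} :=
      measurableSet_lt (by fun_prop) measurable_const
    have h2 : Measurable fun p : (ℝ × ℝ) × ℝ => k p.1.2 (p.1.1 ^ 2 / (p.1.1 ^ 2 + p.2 ^ 2)) :=
      hk.comp (f := fun p : (ℝ × ℝ) × ℝ => (p.1.2, p.1.1 ^ 2 / (p.1.1 ^ 2 + p.2 ^ 2)))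
        (by fun_prop)
    exact (by fun_prop : Measurable fun p : (ℝ × ℝ) × ℝ => ENNReal.ofReal p.1.1).mul
      ((by fun_prop : Measurable fun p : (ℝ × ℝ) × ℝ => ENNReal.ofReal p.2).mul (h2.indicator h1))
  rw [setLIntegral_congr_fun measurableSet_Ioi h2, lintegral_lintegral_swap
    (((hmeas.lintegral_prod_right' (ν := volume.restrict (Ioi (0 : ℝ)))).const_mul _).aemeasurable),
    mul_assoc, ← lintegral_const_mul' _ _ ?_, ← lintegral_const_mul' _ _ ENNReal.ofReal_ne_top]
  · refine lintegral_congr fun φ => ?_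
    rw [lintegral_const_mul' _ _ ENNReal.ofReal_ne_top, lintegral_quadrant
      (k := k φ) (hk.comp measurable_prodMk_left)]
  · refine ne_top_of_le_ne_top (b := ∫⁻ ρ in Ioo (0 : ℝ) 1, 1) (by simp) ?_
    refine setLIntegral_mono measurable_const fun ρ hρ => ?_
    rw [← ENNReal.ofReal_one]
    exact ENNReal.ofReal_le_ofReal (pow_le_one₀ hρ.1.le hρ.2.le)

end PolarCoordinates

/-! ### The two elementary integrals -/

section MeanAngle

open Set Real

/-- The mean coset angle, up to normalization, over the quaternions
`cos χ (cos φ + sin φ i) + sin χ w` with `w` in the plane orthogonal to `1` and `i`. -/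
def meanAngle (φ : ℝ) : ℝ :=
  ∫ χ in (0 : ℝ)..(π / 2),
    cos χ * sin χ * arccos (2 * (cos χ ^ 2 * max (cos φ ^ 2) (sin φ ^ 2)) - 1)

theorem continuous_meanAngle : Continuous meanAngle := by
  unfold meanAngle
  refine intervalIntegral.continuous_parametric_intervalIntegral_of_continuous' ?_ _ _
  have h : Continuous fun p : ℝ × ℝ =>
      2 * (cos p.2 ^ 2 * max (cos p.1 ^ 2) (sin p.1 ^ 2)) - 1 := by fun_prop
  exact (by fun_prop : Continuous fun p : ℝ × ℝ => cos p.2 * sin p.2).mul (continuous_arccos.comp h)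

/-- The shift exchanges `cos²` and `sin²`; on quaternions it is multiplication by `i_a`, that is,
the passage to the other element of the coset. -/
theorem meanAngle_periodic : Function.Periodic meanAngle (π / 2) := fun φ => by
  simp only [meanAngle, cos_add_pi_div_two, sin_add_pi_div_two, neg_sq, max_comm]

theorem meanAngle_neg (φ : ℝ) : meanAngle (-φ) = meanAngle φ := by
  simp only [meanAngle, cos_neg, sin_neg, neg_sq]

theorem meanAngle_nonneg (φ : ℝ) : 0 ≤ meanAngle φ := by
  refine intervalIntegral.integral_nonneg (by positivity) fun χ hχ => ?_
  exact mul_nonneg (mul_nonneg (cos_nonneg_of_mem_Icc ⟨by linarith [hχ.1, pi_pos], hχ.2⟩)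
    (sin_nonneg_of_nonneg_of_le_pi hχ.1 (by linarith [hχ.2, pi_pos]))) (arccos_nonneg _)

theorem meanAngle_eq {φ : ℝ} (hφ : φ ∈ Ioo 0 (π / 4)) :
    meanAngle φ = φ - tan φ / 2 + (π / 2 - φ) / (2 * cos φ ^ 2) := by
  obtain ⟨h0, h1⟩ := hφ
  have hc : 0 < cos φ := cos_pos_of_mem_Ioo ⟨by linarith, by linarith⟩
  have hs : 0 < sin φ := sin_pos_of_pos_of_lt_pi h0 (by linarith)
  have hmax : max (cos φ ^ 2) (sin φ ^ 2) = cos φ ^ 2 := by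
    refine max_eq_left ?_
    have h2 : 0 < cos (2 * φ) := cos_pos_of_mem_Ioo ⟨by linarith, by linarith⟩
    rw [cos_two_mul'] at h2
    linarith
  have hc1 : cos φ < 1 := by nlinarith [sin_sq_add_cos_sq φ]
  -- With `u = cos φ cos χ` the integrand in `χ` becomes `-4 u arccos u du / (2 cos² φ)`. Since `φ >
  -- 0`, `u` stays below one even at `χ = 0`, where `arccos` would otherwise fail to be
  -- differentiable.
  have hd : ∀ χ ∈ uIcc 0 (π / 2), HasDerivAt (fun χ => -(1 / (2 * cos φ ^ 2)) *
      (2 * (cos φ * cos χ) ^ 2 * arccos (cos φ * cos χ) -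
        (cos φ * cos χ) * √(1 - (cos φ * cos χ) ^ 2) + arcsin (cos φ * cos χ)))
      (cos χ * sin χ * arccos (2 * (cos χ ^ 2 * max (cos φ ^ 2) (sin φ ^ 2)) - 1)) χ := by
    intro χ hχ
    rw [uIcc_of_le (by positivity)] at hχ
    have hcχ : 0 ≤ cos χ := cos_nonneg_of_mem_Icc ⟨by linarith [hχ.1, pi_pos], hχ.2⟩
    have hu0 : 0 ≤ cos φ * cos χ := mul_nonneg hc.le hcχ
    have hu1 : cos φ * cos χ < 1 := by nlinarith [cos_le_one χ]
    have hu : HasDerivAt (fun χ => cos φ * cos χ) (-(cos φ * sin χ)) χ := by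
      simpa using (hasDerivAt_cos χ).const_mul (cos φ)
    rw [hmax, show cos χ ^ 2 * cos φ ^ 2 = (cos φ * cos χ) ^ 2 by ring,
      arccos_two_mul_sq_sub_one hu0 hu1.le]
    have hW : ∀ u : ℝ, 0 ≤ u → u < 1 → HasDerivAt (fun u => 2 * u ^ 2 * arccos u -
        u * √(1 - u ^ 2) + arcsin u) (4 * u * arccos u) u := by
      intro u hu0 hu1
      have hp : 0 < 1 - u ^ 2 := by nlinarith
      have d1 := hasDerivAt_arccos (x := u) (by linarith) hu1.ne
      have d2 := hasDerivAt_arcsin (x := u) (by linarith) hu1.ne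
      have d3 : HasDerivAt (fun u : ℝ => u ^ 2) (2 * u) u := by
        simpa using hasDerivAt_pow 2 u
      have d4 := (d3.const_sub 1).sqrt hp.ne'
      have d5 := (((d3.const_mul 2).mul d1).sub ((hasDerivAt_id u).mul d4)).add d2
      refine d5.congr_deriv ?_
      have hq : √(1 - u ^ 2) ≠ 0 := (sqrt_pos.2 hp).ne'
      have hqq : √(1 - u ^ 2) ^ 2 = 1 - u ^ 2 := sq_sqrt hp.le
      simp only [id]
      field_simp
      linear_combination (-1 : ℝ) * hqq
    have hd1 := ((hW _ hu0 hu1).comp χ hu).const_mul (-(1 / (2 * cos φ ^ 2)))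
    refine hd1.congr_deriv ?_
    field_simp
    norm_num
  have hcont : Continuous fun χ : ℝ =>
      cos χ * sin χ * arccos (2 * (cos χ ^ 2 * max (cos φ ^ 2) (sin φ ^ 2)) - 1) := by
    have h : Continuous fun χ : ℝ => 2 * (cos χ ^ 2 * max (cos φ ^ 2) (sin φ ^ 2)) - 1 := by
      fun_prop
    exact (continuous_cos.mul continuous_sin).mul (continuous_arccos.comp h)
  rw [meanAngle, intervalIntegral.integral_eq_sub_of_hasDerivAt hd (hcont.intervalIntegrable _ _)]
  have hsin : √(1 - cos φ ^ 2) = sin φ := by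
    rw [← sin_sq, sqrt_sq hs.le]
  simp only [cos_zero, mul_one, cos_pi_div_two, mul_zero, arcsin_zero]
  rw [hsin, arccos_cos h0.le (by linarith), arcsin_eq_pi_div_two_sub_arccos,
    arccos_cos h0.le (by linarith), tan_eq_sin_div_cos]
  field_simp
  ring

/-- Period `π/2` and evenness cut the full circle into eight copies of `[0, π/4]`. -/
theorem integral_meanAngle : ∫ φ in (-π)..π, meanAngle φ = π * (1 + π / 4) := by
  have hint : ∀ a b, IntervalIntegrable meanAngle volume a b :=
    fun a b => continuous_meanAngle.intervalIntegrable a b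
  have h1 : ∫ φ in (0 : ℝ)..(π / 4), meanAngle φ = (π ^ 2 / 16 + π / 4) / 2 := by
    -- Differentiating `(π/2 - φ) tan φ` produces the `tan` and `1/cos²` terms of `meanAngle_eq`
    -- together.
    have hd : ∀ φ ∈ Ioo 0 (π / 4), HasDerivAt (fun φ => (φ ^ 2 + (π / 2 - φ) * tan φ) / 2)
        (meanAngle φ) φ := by
      intro φ hφ
      have hc : 0 < cos φ := cos_pos_of_mem_Ioo ⟨by linarith [hφ.1, pi_pos],
        by linarith [hφ.2, pi_pos]⟩
      have d1 : HasDerivAt (fun u : ℝ => u ^ 2) (2 * φ) φ := by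
        simpa using hasDerivAt_pow 2 φ
      have d2 := (d1.add (((hasDerivAt_id φ).const_sub (π / 2)).mul
        (hasDerivAt_tan hc.ne'))).div_const 2
      refine d2.congr_deriv ?_
      rw [meanAngle_eq hφ]
      simp only [id]
      field_simp
      ring
    have hcont : ContinuousOn (fun φ => (φ ^ 2 + (π / 2 - φ) * tan φ) / 2) (Icc 0 (π / 4)) := by
      intro φ hφ
      have hc : 0 < cos φ := cos_pos_of_mem_Ioo ⟨by linarith [hφ.1, pi_pos], by
        linarith [hφ.2, pi_pos]⟩
      refine ContinuousAt.continuousWithinAt ?_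
      have := continuousAt_tan.2 hc.ne'
      fun_prop
    rw [intervalIntegral.integral_eq_sub_of_hasDerivAt_of_le (by positivity) hcont hd (hint _ _)]
    simp only [tan_pi_div_four, tan_zero]
    ring
  have h2 : ∫ φ in (-(π / 4))..0, meanAngle φ = ∫ φ in (0 : ℝ)..(π / 4), meanAngle φ := by
    have := intervalIntegral.integral_comp_neg (a := 0) (b := π / 4) meanAngle
    simp only [meanAngle_neg, neg_zero] at this
    exact this.symm
  have h3 := meanAngle_periodic.intervalIntegral_add_zsmul_eq 4 (-π) hint
  have h4 := meanAngle_periodic.intervalIntegral_add_eq (-π) (-(π / 4))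
  rw [show -(π / 4) + π / 2 = π / 4 by ring,
    ← intervalIntegral.integral_add_adjacent_intervals (hint (-(π / 4)) 0) (hint 0 (π / 4)),
    h2, h1] at h4
  rw [h4, show -π + (4 : ℤ) • (π / 2) = π by rw [zsmul_eq_mul]; push_cast; ring] at h3
  rw [h3, zsmul_eq_mul]
  push_cast
  ring

end MeanAngle

/-! ### The mean coset angle and the expected distance -/

section Expectation

open Set Real Fl

/-- `arccos` is decreasing, so the smaller angle belongs to the larger squared coordinate. -/
theorem cosetAngle_toSO_quatEquiv (a : Fin 3) {v : (ℝ × ℝ) × (ℝ × ℝ)} (hv : v ≠ 0) :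
    cosetAngle (halfTurn a) (toSO (quatEquiv a v)) =
      arccos (2 * (max (v.1.1 ^ 2) (v.1.2 ^ 2) / sqNorm v) - 1) := by
  have hq : quatEquiv a v ≠ 0 := (quatEquiv a).map_ne_zero_iff.2 hv
  have hN : 0 ≤ sqNorm v := by
    unfold sqNorm
    positivity
  rw [cosetAngle, ← toSO_imUnit, ← toSO_mul hq (imUnit_ne_zero a), angle_toSO_eq hq,
    angle_toSO_eq (mul_ne_zero hq (imUnit_ne_zero a)), re_quatEquiv_mul_imUnit, map_mul,
    normSq_imUnit, mul_one, normSq_quatEquiv, re_quatEquiv, neg_sq, ← antitone_arccos.map_max]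
  congr 1
  rw [max_sub_sub_right, max_div_div_right hN, ← mul_max_of_nonneg _ _ zero_le_two, mul_div_assoc]

theorem lintegral_cosetAngle (a : Fin 3) :
    ∫⁻ g, ENNReal.ofReal (cosetAngle (halfTurn a) g) ∂haarSO 3 = ENNReal.ofReal (1 + π / 4) := by
  set k : ℝ → ℝ → ℝ≥0∞ := fun φ y =>
    ENNReal.ofReal (arccos (2 * (y * max (cos φ ^ 2) (sin φ ^ 2)) - 1)) with hk
  set h : (ℝ × ℝ) × (ℝ × ℝ) → ℝ≥0∞ := fun v =>
    ENNReal.ofReal (arccos (2 * (max (v.1.1 ^ 2) (v.1.2 ^ 2) / sqNorm v) - 1)) with hh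
  have hkm : Measurable (Function.uncurry k) := by
    refine ENNReal.measurable_ofReal.comp (measurable_arccos.comp ?_)
    fun_prop
  have hhm : Measurable h := by
    refine ENNReal.measurable_ofReal.comp (measurable_arccos.comp ?_)
    have := continuous_sqNorm.measurable
    fun_prop
  set C := ENNReal.ofReal (2 * π) * ∫⁻ ρ in Ioo (0 : ℝ) 1, ENNReal.ofReal (ρ ^ 3) with hC
  -- The same formula applied to the constant `1` gives the normalization: the `χ`-integral is `1/2`
  -- and the `φ`-interval has length `2π`.
  have hvol : volume unitBall = C * ENNReal.ofReal π := by
    have h1 := lintegral_unitBall_eq (h := fun _ => 1) measurable_const (k := fun _ _ => 1)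
      measurable_const (fun _ _ _ _ _ _ => rfl)
    rw [setLIntegral_one] at h1
    rw [h1]
    congr 1
    have h2 : ∫ χ in (0 : ℝ)..(π / 2), cos χ * sin χ = 1 / 2 := by
      simp_rw [mul_comm (cos _)]
      rw [integral_sin_mul_cos₁]
      simp
    have h3 : ∫⁻ χ in Ioo 0 (π / 2), ENNReal.ofReal (cos χ * sin χ) * 1 =
        ENNReal.ofReal (1 / 2) := by
      rw [← h2, intervalIntegral.integral_of_le (by positivity), integral_Ioc_eq_integral_Ioo,
        ofReal_integral_eq_lintegral_ofReal]
      · simp only [mul_one]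
      · exact (by fun_prop : Continuous fun χ => cos χ * sin χ).integrableOn_Ioc.mono_set
          Ioo_subset_Ioc_self
      · filter_upwards [self_mem_ae_restrict measurableSet_Ioo] with χ hχ
        obtain ⟨hc, hs⟩ := (cos_sin_pos_iff ⟨by linarith [hχ.1, pi_pos],
          by linarith [hχ.2, pi_pos]⟩).2 hχ
        exact (mul_pos hc hs).le
    rw [h3, setLIntegral_const, Real.volume_Ioo, ← ENNReal.ofReal_mul (by norm_num)]
    congr 1
    ring
  have hC0 : C ≠ 0 := fun h0 => volume_unitBall_ne_zero (by rw [hvol, h0, zero_mul])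
  have hCtop : C ≠ ⊤ := fun h0 => volume_unitBall_ne_top (by
    rw [hvol, h0, ENNReal.top_mul (by simp [pi_pos])])
  have hmean : ∀ φ, ∫⁻ χ in Ioo 0 (π / 2), ENNReal.ofReal (cos χ * sin χ) * k φ (cos χ ^ 2) =
      ENNReal.ofReal (meanAngle φ) := by
    intro φ
    have hcont : Continuous fun χ : ℝ =>
        cos χ * sin χ * arccos (2 * (cos χ ^ 2 * max (cos φ ^ 2) (sin φ ^ 2)) - 1) := by
      have h : Continuous fun χ : ℝ => 2 * (cos χ ^ 2 * max (cos φ ^ 2) (sin φ ^ 2)) - 1 := by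
        fun_prop
      exact (continuous_cos.mul continuous_sin).mul (continuous_arccos.comp h)
    have hpos : ∀ χ ∈ Ioo 0 (π / 2), 0 ≤ cos χ * sin χ := fun χ hχ => by
      obtain ⟨hc, hs⟩ := (cos_sin_pos_iff ⟨by linarith [hχ.1, pi_pos],
        by linarith [hχ.2, pi_pos]⟩).2 hχ
      exact (mul_pos hc hs).le
    rw [meanAngle, intervalIntegral.integral_of_le (by positivity), integral_Ioc_eq_integral_Ioo,
      ofReal_integral_eq_lintegral_ofReal]
    · refine setLIntegral_congr_fun measurableSet_Ioo fun χ hχ => ?_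
      exact (ENNReal.ofReal_mul (hpos χ hχ)).symm
    · exact hcont.integrableOn_Ioc.mono_set Ioo_subset_Ioc_self
    · filter_upwards [self_mem_ae_restrict measurableSet_Ioo] with χ hχ
      exact mul_nonneg (hpos χ hχ) (arccos_nonneg _)
  have hball := lintegral_unitBall_eq hhm hkm fun r φ s ψ hr hs => by
    simp only [hh, hk, sqNorm]
    congr 4
    rw [show (r * cos φ) ^ 2 + (r * sin φ) ^ 2 + ((s * cos ψ) ^ 2 + (s * sin ψ) ^ 2) =
      r ^ 2 + s ^ 2 by
        linear_combination r ^ 2 * sin_sq_add_cos_sq φ + s ^ 2 * sin_sq_add_cos_sq ψ,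
      mul_pow, mul_pow, ← mul_max_of_nonneg _ _ (sq_nonneg r)]
    ring
  have htot : ∫⁻ φ in Ioo (-π) π, ENNReal.ofReal (meanAngle φ) =
      ENNReal.ofReal (π * (1 + π / 4)) := by
    rw [← integral_meanAngle, intervalIntegral.integral_of_le (by linarith [pi_pos]),
      integral_Ioc_eq_integral_Ioo, ofReal_integral_eq_lintegral_ofReal
      (continuous_meanAngle.integrableOn_Ioc.mono_set Ioo_subset_Ioc_self)
      (Filter.Eventually.of_forall meanAngle_nonneg)]
  simp only [hmean] at hball
  rw [htot, ENNReal.ofReal_mul pi_pos.le, ← hC, ← mul_assoc, ← hvol] at hball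
  have hF : Measurable fun g => ENNReal.ofReal (cosetAngle (halfTurn a) g) :=
    ENNReal.measurable_ofReal.comp (continuous_cosetAngle _).measurable
  have hmain := lintegral_haarSO a hF
  -- The origin, where `toSO` takes a default value, is a null set.
  rw [setLIntegral_congr_fun_ae isOpen_unitBall.measurableSet (g := h) (by
    filter_upwards [ae_ne_zero] with v hv _
    rw [cosetAngle_toSO_quatEquiv a hv]), hball, mul_comm] at hmain
  exact (ENNReal.mul_right_inj volume_unitBall_ne_zero volume_unitBall_ne_top).1 hmain

theorem integral_cosetAngle (a : Fin 3) :
    ∫ g, cosetAngle (halfTurn a) g ∂haarSO 3 = 1 + π / 4 := by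
  rw [integral_eq_lintegral_of_nonneg_ae (Filter.Eventually.of_forall fun g => cosetAngle_nonneg _ g)
    (continuous_cosetAngle _).aestronglyMeasurable, lintegral_cosetAngle,
    ENNReal.toReal_ofReal (by positivity)]

section Fl

variable {n : ℕ} {c : Composition n} {P : Finpartition (Finset.univ : Finset (Fin c.length))}

/-- Makes the product σ-algebra on pairs Borel, so that the continuous distance is measurable. -/
instance secondCountableTopology_Fl : SecondCountableTopology (Fl c P) :=
  inferInstanceAs (SecondCountableTopology (SO n ⧸ SG c P))

theorem continuous_proj : Continuous (proj c P) := QuotientGroup.continuous_mk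

theorem measurable_proj : Measurable (proj c P) := continuous_proj.measurable

end Fl

section Law

variable {c : Composition 3} {P : Finpartition (Finset.univ : Finset (Fin c.length))} {k : SO 3}
  {Ω : Type*} [MeasurableSpace Ω] {μ : Measure Ω} {X Y : Ω → Fl c P}

theorem norm_cosetAngle_le (k g : SO 3) : ‖cosetAngle k g‖ ≤ π := by
  rw [Real.norm_of_nonneg (cosetAngle_nonneg _ _)]
  exact (min_le_left _ _).trans (angle_le_pi _)

theorem norm_geodesicDist_le (hk : k * k = 1) (hK : ∀ A, A ∈ SG c P ↔ A = 1 ∨ A = k)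
    (x y : Fl c P) : ‖geodesicDist x y‖ ≤ π := by
  obtain ⟨A, rfl⟩ := proj_surjective x
  obtain ⟨B, rfl⟩ := proj_surjective y
  rw [geodesicDist_proj hk hK]
  exact norm_cosetAngle_le _ _

theorem geodesicEDist_ne_top (hk : k * k = 1) (hK : ∀ A, A ∈ SG c P ↔ A = 1 ∨ A = k)
    (x y : Fl c P) : geodesicEDist x y ≠ ⊤ := by
  obtain ⟨A, rfl⟩ := proj_surjective x
  obtain ⟨B, rfl⟩ := proj_surjective y
  rw [geodesicEDist_proj hk hK]
  exact ENNReal.ofReal_ne_top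

theorem integrable_geodesicDist [IsFiniteMeasure μ] (hk : k * k = 1)
    (hK : ∀ A, A ∈ SG c P ↔ A = 1 ∨ A = k) (hX : AEMeasurable X μ) (hY : AEMeasurable Y μ) :
    Integrable (fun ω => geodesicDist (X ω) (Y ω)) μ := by
  have hm : Measurable fun p : Fl c P × Fl c P => geodesicDist p.1 p.2 :=
    (continuous_geodesicDist hk hK).measurable
  have hXY : AEMeasurable ((fun p : Fl c P × Fl c P => geodesicDist p.1 p.2) ∘
      fun ω => (X ω, Y ω)) μ := hm.comp_aemeasurable (hX.prodMk hY)
  have hb : ∀ᵐ ω ∂μ, ‖((fun p : Fl c P × Fl c P => geodesicDist p.1 p.2) ∘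
      fun ω => (X ω, Y ω)) ω‖ ≤ π :=
    Filter.Eventually.of_forall fun ω => norm_geodesicDist_le hk hK (X ω) (Y ω)
  exact Integrable.of_bound hXY.aestronglyMeasurable π hb

/-- Lift both points to independent Haar rotations. For a fixed first one, left invariance turns the
integral over the second into the mean of `cosetAngle`, independent of the first. -/
theorem integral_geodesicDist [IsProbabilityMeasure μ] (hk : k * k = 1)
    (hK : ∀ A, A ∈ SG c P ↔ A = 1 ∨ A = k) (hX : HasLaw X (uniform c P) μ)
    (hY : HasLaw Y (uniform c P) μ) (hXY : IndepFun X Y μ) :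
    ∫ ω, geodesicDist (X ω) (Y ω) ∂μ = ∫ g, cosetAngle k g ∂haarSO 3 := by
  have hm : Measurable (proj c P) := measurable_proj
  have hd : Measurable fun p : Fl c P × Fl c P => geodesicDist p.1 p.2 :=
    (continuous_geodesicDist hk hK).measurable
  have hlaw : μ.map (fun ω => (X ω, Y ω)) =
      ((haarSO 3).prod (haarSO 3)).map (Prod.map (proj c P) (proj c P)) := by
    rw [← Measure.map_prod_map _ _ hm hm,
      (indepFun_iff_map_prod_eq_prod_map_map hX.aemeasurable hY.aemeasurable).1 hXY, hX.map_eq,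
      hY.map_eq]
    rfl
  have h1 := integral_map (f := fun p : Fl c P × Fl c P => geodesicDist p.1 p.2)
    (hX.aemeasurable.prodMk hY.aemeasurable) hd.aestronglyMeasurable
  have h2 := integral_map (f := fun p : Fl c P × Fl c P => geodesicDist p.1 p.2)
    (μ := (haarSO 3).prod (haarSO 3)) (hm.prodMap hm).aemeasurable hd.aestronglyMeasurable
  have hcc : Continuous fun p : SO 3 × SO 3 => cosetAngle k (p.1⁻¹ * p.2) :=
    (continuous_cosetAngle _).comp (continuous_fst.inv.mul continuous_snd)
  have hint : Integrable (fun p : SO 3 × SO 3 => cosetAngle k (p.1⁻¹ * p.2))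
      ((haarSO 3).prod (haarSO 3)) :=
    Integrable.of_bound hcc.aestronglyMeasurable π
      (Filter.Eventually.of_forall fun p => norm_cosetAngle_le _ _)
  rw [← h1, hlaw, h2]
  simp only [Prod.map_fst, Prod.map_snd, geodesicDist_proj hk hK]
  rw [integral_prod _ hint]
  simp only [integral_mul_left_eq_self (μ := haarSO 3) (fun g => cosetAngle k g), integral_const,
    probReal_univ, one_smul]

end Law

end Expectation

end OrientedFlag

end

theorem mainTheorem1
    (P : Finpartition (Finset.univ : Finset (Fin (Composition.ones 3).length)))
    (hP : OrientedFlag.IsProperPartition P)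
    {Ω : Type*} [MeasurableSpace Ω] (μ : Measure Ω) [IsProbabilityMeasure μ]
    (X Y : Ω → OrientedFlag.Fl (Composition.ones 3) P)
    (hX : HasLaw X (OrientedFlag.Fl.uniform (Composition.ones 3) P) μ)
    (hY : HasLaw Y (OrientedFlag.Fl.uniform (Composition.ones 3) P) μ)
    (hXY : IndepFun X Y μ) :
    (∀ x y : OrientedFlag.Fl (Composition.ones 3) P, OrientedFlag.Fl.geodesicEDist x y ≠ ⊤) ∧
      Integrable (fun ω => OrientedFlag.Fl.geodesicDist (X ω) (Y ω)) μ ∧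
      ∫ ω, OrientedFlag.Fl.geodesicDist (X ω) (Y ω) ∂μ = 1 + Real.pi / 4 := by
  obtain ⟨a, hK⟩ := OrientedFlag.exists_mem_SG_iff P hP
  have hk := OrientedFlag.halfTurn_mul_self a
  exact ⟨OrientedFlag.geodesicEDist_ne_top hk hK,
    OrientedFlag.integrable_geodesicDist hk hK hX.aemeasurable hY.aemeasurable,
    (OrientedFlag.integral_geodesicDist hk hK hX hY hXY).trans (OrientedFlag.integral_cosetAngle a)⟩
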